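/- Let $f\colon (R,\mathfrak m,k)\to(S,\mathfrak n,\ell)$ be a local homomorphism of (commutative, Noetherian) local rings such that $S$ is a finitely generated $R$-module via $f$, and let $d=\dim R\ge 1$. Let $M$ be an $S$-module, regarded also as an $R$-module via $f$, and let $N$ be an $R$-module (not necessarily finitely generated). For an $R$-module $X$ put $X^\vee=\operatorname{Hom}_R(X,E_R(k))$, where $E_R(k)$ is the injective hull of the residue field $k$; write $\operatorname{id}$ and $\operatorname{fd}$ for injective and flat dimension. Assume that the following hold. (i) There is an integer $t\ge 1$ such that $\operatorname{Ext}^i_R(M,N)=0$ for all $i=t,t+1,\dots,t+d-1$. (ii) $M$ is finitely generated over $S$ and $\operatorname{Supp}_R(M)=\operatorname{Spec}(R)$. (iii) There is an $M$-regular sequence $x_1,\dots,x_d\in\mathfrak n$ such that $\mathfrak m M\subseteq (x_1,\dots,x_d)M$. (iv) $\operatorname{id}_{R_{\mathfrak p}}(N_{\mathfrak p})<\infty$ for all $\mathfrak p\in\operatorname{Spec}(R)\setminus\{\mathfrak m\}$. (v) $\operatorname{fd}_{R_{\mathfrak p}}\big((N^\vee)_{\mathfrak p}\big)<\infty$ for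 all $\mathfrak p\in\operatorname{Ass}(R)$. Then $\operatorname{id}_R(N)\le d$. -/

import Mathlib

universe u v

/-- `E` is an injective hull of the `R`-module `A`: it is injective, and it is an essential
extension of `A` along some embedding `A → E`. -/
def IsInjectiveHull (R : Type u) [CommRing R] (A : Type u) [AddCommGroup A] [Module R A]
    (E : Type u) [AddCommGroup E] [Module R E] : Prop :=
  Module.Injective R E ∧ ∃ ι : A →ₗ[R] E, Function.Injective ι ∧
    ∀ K : Submodule R E, K ⊓ LinearMap.range ι = ⊥ → K = ⊥

/-- Every module has an injective hull. -/
theorem exists_isInjectiveHull (R : Type u) [CommRing R] (A : Type u) [AddCommGroup A]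
    [Module R A] : ∃ E : ModuleCat.{u} R, IsInjectiveHull R A E := by
  -- an embedding of `A` into an injective module `J`
  obtain ⟨J, hJ, i, hi⟩ : ∃ J : ModuleCat.{u} R, Module.Injective R J ∧
      ∃ i : A →ₗ[R] J, Function.Injective i := by
    obtain ⟨⟨J, hJ, f, hf⟩⟩ := CategoryTheory.EnoughInjectives.presentation (ModuleCat.of R A)
    have : CategoryTheory.Injective (ModuleCat.of R J) := hJ
    exact ⟨J, Module.injective_module_of_injective_object R J, f.hom,
      (ModuleCat.mono_iff_injective f).mp hf⟩
  set B := LinearMap.range i with hB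
  -- a maximal essential extension `E` of `B` in `J`
  obtain ⟨E, hBE, hE, hmax⟩ := zorn_le_nonempty₀
    {K : Submodule R J | B ≤ K ∧ ∀ L ≤ K, L ⊓ B = ⊥ → L = ⊥} (by
      intro c hc hchain y hy
      refine ⟨sSup c, ⟨(hc hy).1.trans (le_sSup hy), fun L hL hLB => ?_⟩, fun z => le_sSup⟩
      rw [eq_bot_iff]
      intro x hx
      obtain ⟨K, hK, hxK⟩ := (Submodule.mem_sSup_of_directed ⟨y, hy⟩ hchain.directedOn).1 (hL hx)
      have h1 : L ⊓ K = ⊥ := (hc hK).2 _ inf_le_right (by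
        rw [eq_bot_iff, ← hLB]
        exact inf_le_inf_right _ inf_le_left)
      rw [← h1]
      exact ⟨hx, hxK⟩) B ⟨le_rfl, fun L hL h => by rwa [inf_eq_left.2 hL] at h⟩
  -- a maximal complement `C` of `E`
  obtain ⟨C, -, hC, hCmax⟩ := zorn_le_nonempty₀ {K : Submodule R J | K ⊓ E = ⊥} (by
      intro c hc hchain y hy
      refine ⟨sSup c, ?_, fun z => le_sSup⟩
      change _ = _
      rw [eq_bot_iff]
      rintro x ⟨hx, hxE⟩
      obtain ⟨K, hK, hxK⟩ := (Submodule.mem_sSup_of_directed ⟨y, hy⟩ hchain.directedOn).1 hx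
      rw [← (hc hK : K ⊓ E = ⊥)]
      exact ⟨hxK, hxE⟩) ⊥ (bot_inf_eq _)
  replace hC : C ⊓ E = ⊥ := hC
  -- `E → J / C` is an essential monomorphism; extend the inclusion of `E` to `J / C`
  obtain ⟨φ, hφ⟩ := hJ.out (C.mkQ ∘ₗ E.subtype) (by
    rw [← LinearMap.ker_eq_bot, eq_bot_iff]
    intro x hx
    have hxC : (x : J) ∈ C := by simpa using hx
    have : (x : J) ∈ C ⊓ E := ⟨hxC, x.2⟩
    rw [hC] at this
    simpa using this) E.subtype
  have hφ' : ∀ x ∈ E, φ (C.mkQ x) = x := fun x hx => hφ ⟨x, hx⟩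
  set g : J →ₗ[R] J := φ ∘ₗ C.mkQ with hg
  have hgE : ∀ x ∈ E, g x = x := hφ'
  have hker : LinearMap.ker g = C := by
    have hle : C ≤ LinearMap.ker g := by
      intro x hx
      have : C.mkQ x = 0 := by simpa using hx
      simp [hg, -Submodule.mkQ_apply, this]
    refine le_antisymm (hCmax ?_ hle) hle
    change _ = _
    rw [eq_bot_iff]
    rintro x ⟨hx, hxE⟩
    rw [← hgE x hxE]
    simpa using hx
  have hrange : LinearMap.range g ≤ E := by
    refine hmax ⟨hBE.trans fun x hx => ⟨x, hgE x hx⟩, fun L hL hLB => ?_⟩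
      fun x hx => ⟨x, hgE x hx⟩
    have hLE : L ⊓ E = ⊥ := hE.2 _ inf_le_right (by
      rw [eq_bot_iff, ← hLB]
      exact inf_le_inf_right _ inf_le_left)
    have h1 : L.comap g = C := by
      refine le_antisymm (hCmax ?_ ?_) ?_
      · change _ = _
        rw [eq_bot_iff, ← hLE]
        rintro x ⟨hx, hxE⟩
        refine ⟨?_, hxE⟩
        rw [← hgE x hxE]
        exact hx
      · rw [← hker]
        exact LinearMap.ker_le_comap g
      · rw [← hker]
        exact LinearMap.ker_le_comap g
    rw [eq_bot_iff]
    intro x hx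
    obtain ⟨y, rfl⟩ := hL hx
    have : y ∈ L.comap g := hx
    rw [h1, ← hker] at this
    simpa using this
  refine ⟨ModuleCat.of R E, ⟨fun X Y _ _ _ _ f hf h => ?_⟩, ?_⟩
  · obtain ⟨k, hk⟩ := hJ.out f hf (E.subtype ∘ₗ h)
    refine ⟨(g.codRestrict E fun x => hrange ⟨x, rfl⟩) ∘ₗ k, fun x => ?_⟩
    apply Subtype.ext
    change g (k (f x)) = _
    rw [hk]
    exact hgE _ (h x).2
  · refine ⟨i.codRestrict E fun x => hBE ⟨x, rfl⟩, fun x y hxy => ?_, fun K hK => ?_⟩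
    · exact hi (congrArg Subtype.val hxy)
    · have h1 : K.map E.subtype = ⊥ := hE.2 _ (Submodule.map_subtype_le E K) (by
        rw [eq_bot_iff]
        rintro _ ⟨⟨x, hx, rfl⟩, ⟨a, ha⟩⟩
        have : x ∈ K ⊓ LinearMap.range (i.codRestrict E fun x => hBE ⟨x, rfl⟩) :=
          ⟨hx, a, Subtype.ext ha⟩
        rw [hK] at this
        have h0 : x = 0 := by simpa using this
        simp [h0])
      exact Submodule.map_injective_of_injective E.injective_subtype (by rw [h1, Submodule.map_bot])

/-- The injective hull `E_R(A)` of an `R`-module `A` (unique up to isomorphism). -/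
noncomputable def injectiveHull (R : Type u) [CommRing R] (A : Type u) [AddCommGroup A]
    [Module R A] : ModuleCat.{u} R :=
  (exists_isInjectiveHull R A).choose

theorem isInjectiveHull_injectiveHull (R : Type u) [CommRing R] (A : Type u) [AddCommGroup A]
    [Module R A] : IsInjectiveHull R A (injectiveHull R A) :=
  (exists_isInjectiveHull R A).choose_spec

/-- The Matlis dual `N^∨ = Hom_R(N, E_R(k))` of a module over a local ring with residue
field `k`. -/
abbrev MatlisDual (R : Type u) [CommRing R] [IsLocalRing R] (N : Type u) [AddCommGroup N]
    [Module R N] : Type u :=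
  N →ₗ[R] injectiveHull R (IsLocalRing.ResidueField R)

/-- `M` has a flat resolution of length at most `n`, that is, there is an exact sequence
`0 → F n → ⋯ → F 1 → F 0 → M → 0` with all `F i` flat. -/
def HasFlatDimensionLE (R : Type u) [CommRing R] (M : Type u) [AddCommGroup M] [Module R M]
    (n : ℕ) : Prop :=
  ∃ (F : ℕ → ModuleCat.{u} R) (δ : ∀ i, F (i + 1) →ₗ[R] F i) (ε : F 0 →ₗ[R] M),
    (∀ i, Module.Flat R (F i)) ∧ (∀ i, n < i → Subsingleton (F i)) ∧
    Function.Surjective ε ∧ Function.Exact (δ 0) ε ∧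
    ∀ i, Function.Exact (δ (i + 1)) (δ i)

/-- The flat dimension of a module: the least length of a flat resolution, and `⊤` if there is
no finite one. (The zero module gets the value `0`.) -/
noncomputable def flatDimension (R : Type u) [CommRing R] (M : Type u) [AddCommGroup M]
    [Module R M] : ℕ∞ :=
  ⨅ (n : ℕ) (_ : HasFlatDimensionLE R M n), (n : ℕ∞)

theorem flatDimension_lt_top_iff (R : Type u) [CommRing R] (M : Type u) [AddCommGroup M]
    [Module R M] : flatDimension R M < ⊤ ↔ ∃ n : ℕ, HasFlatDimensionLE R M n := by
  simp [flatDimension, iInf_lt_iff]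

/-! Let `I j` be the terms and `C j` the cosyzygies of the minimal injective resolution of `N`, so
that each `C j → I j` is essential, and put `s = t + d - 1`. It suffices that `C (s + 1) = 0`: then
`N` has finite injective dimension, and over a Noetherian ring of dimension at most `d` this forces
the bound `d`, without finite generation (`hasInjectiveDimensionLT_of_ringKrullDim_le`).

Finite injective dimension on the punctured spectrum makes `C s`, hence also `I s`, `m`-power
torsion (`minimalCosyzygy_torsion`). Then every map `M → I s` lands in `C s`
(`comp_eq_zero_of_isWeaklyRegular`). Indeed, modulo the regular sequence `M` is killed by `m`, so
its maps hit only the socle of `I s`, which lies in `C s` by essentiality; vanishing of Ext carries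
this back to `M`, one element of the sequence at a time.

Thus `Hom(M, I s) → Hom(M, C (s + 1))` is zero. Write `^∨` for `Hom(-, E)`. For finite `M`, `M ⊗ (I
s)^∨` embeds in `Hom(M, I s)^∨` (`tensorHomEval_injective`), so `M ⊗ C (s + 1)^∨ → M ⊗ (I s)^∨` is
zero. At an associated prime of `R` the duals of the late cosyzygies are flat, so this map is also
injective there; full support of `M` kills `C (s + 1)^∨` at that prime. A submodule of the flat
module `(I s)^∨` that vanishes at all associated primes is zero (`subsingleton_of_lTensor_eq_zero`),
and `E` is a cogenerator, so `C (s + 1) = 0`. -/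

open CategoryTheory

/-! ### Long exact sequences of Ext and dimension shifting -/

section ExtTools

variable {A : Type u} [CommRing A] {X Y Z : Type u} [AddCommGroup X] [Module A X]
  [AddCommGroup Y] [Module A Y] [AddCommGroup Z] [Module A Z]
  {f : X →ₗ[A] Y} {g : Y →ₗ[A] Z}

theorem exists_shortExact_of_exact (hf : Function.Injective f) (hfg : Function.Exact f g)
    (hg : Function.Surjective g) :
    ∃ w : ModuleCat.ofHom f ≫ ModuleCat.ofHom g = 0,
      (ShortComplex.mk (ModuleCat.ofHom f) (ModuleCat.ofHom g) w).ShortExact := by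
  refine ⟨?_, ModuleCat.shortComplex_shortExact _ hfg hf hg⟩
  ext x
  exact hfg.apply_apply_eq_zero x

theorem subsingleton_ext_third (hf : Function.Injective f) (hfg : Function.Exact f g)
    (hg : Function.Surjective g) (N : Type u) [AddCommGroup N] [Module A N] {n : ℕ}
    (hX : Subsingleton (Abelian.Ext (ModuleCat.of A X) (ModuleCat.of A N) n))
    (hY : Subsingleton (Abelian.Ext (ModuleCat.of A Y) (ModuleCat.of A N) (n + 1))) :
    Subsingleton (Abelian.Ext (ModuleCat.of A Z) (ModuleCat.of A N) (n + 1)) := by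
  obtain ⟨w, hS⟩ := exists_shortExact_of_exact hf hfg hg
  refine subsingleton_of_forall_eq 0 fun e => ?_
  obtain ⟨e', rfl⟩ := Abelian.Ext.contravariant_sequence_exact₃ hS (ModuleCat.of A N) e
    (hY.elim _ _) (add_comm 1 n)
  rw [hX.elim e' 0, Abelian.Ext.comp_zero]

theorem subsingleton_ext_first (hf : Function.Injective f) (hfg : Function.Exact f g)
    (hg : Function.Surjective g) (N : Type u) [AddCommGroup N] [Module A N] {n : ℕ}
    (hY : Subsingleton (Abelian.Ext (ModuleCat.of A Y) (ModuleCat.of A N) n))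
    (hZ : Subsingleton (Abelian.Ext (ModuleCat.of A Z) (ModuleCat.of A N) (n + 1))) :
    Subsingleton (Abelian.Ext (ModuleCat.of A X) (ModuleCat.of A N) n) := by
  obtain ⟨w, hS⟩ := exists_shortExact_of_exact hf hfg hg
  refine subsingleton_of_forall_eq 0 fun e => ?_
  obtain ⟨e', rfl⟩ := Abelian.Ext.contravariant_sequence_exact₁ hS (ModuleCat.of A N) e
    (add_comm 1 n) (hZ.elim _ _)
  rw [hY.elim e' 0, Abelian.Ext.comp_zero]

theorem subsingleton_ext_cosyzygy [Module.Injective A Y] (hf : Function.Injective f)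
    (hfg : Function.Exact f g) (hg : Function.Surjective g) (L : Type u) [AddCommGroup L]
    [Module A L] {n : ℕ}
    (h : Subsingleton (Abelian.Ext (ModuleCat.of A L) (ModuleCat.of A X) (n + 2))) :
    Subsingleton (Abelian.Ext (ModuleCat.of A L) (ModuleCat.of A Z) (n + 1)) := by
  obtain ⟨w, hS⟩ := exists_shortExact_of_exact hf hfg hg
  have : Injective (ModuleCat.of A Y) := (Module.injective_iff_injective_object A Y).1 ‹_›
  refine subsingleton_of_forall_eq 0 fun e => ?_
  obtain ⟨e', rfl⟩ := Abelian.Ext.covariant_sequence_exact₃ (ModuleCat.of A L) hS e rfl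
    (h.elim _ _)
  rw [Abelian.Ext.eq_zero_of_injective e', Abelian.Ext.zero_comp]

/-- Vanishing of `Ext¹` gives liftings along an epimorphism. -/
theorem exists_lift_of_subsingleton_ext_one (hf : Function.Injective f)
    (hfg : Function.Exact f g) (hg : Function.Surjective g) {L : Type u} [AddCommGroup L]
    [Module A L]
    (h : Subsingleton (Abelian.Ext (ModuleCat.of A L) (ModuleCat.of A X) 1))
    (φ : L →ₗ[A] Z) : ∃ ψ : L →ₗ[A] Y, g ∘ₗ ψ = φ := by
  obtain ⟨w, hS⟩ := exists_shortExact_of_exact hf hfg hg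
  obtain ⟨e, he⟩ := Abelian.Ext.covariant_sequence_exact₃ (ModuleCat.of A L) hS
    (Abelian.Ext.mk₀ (ModuleCat.ofHom φ)) rfl (h.elim _ _)
  obtain ⟨ψ, rfl⟩ := Abelian.Ext.homEquiv₀.symm.surjective e
  refine ⟨ψ.hom, ?_⟩
  rw [Abelian.Ext.homEquiv₀_symm_apply, Abelian.Ext.mk₀_comp_mk₀] at he
  have := Abelian.Ext.homEquiv₀.symm.injective he
  exact congrArg ModuleCat.Hom.hom this

theorem subsingleton_ext_of_free (L N : Type u) [AddCommGroup L] [Module A L] [AddCommGroup N]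
    [Module A N] [Module.Free A L] (n : ℕ) :
    Subsingleton (Abelian.Ext (ModuleCat.of A L) (ModuleCat.of A N) (n + 1)) := by
  have : Projective (ModuleCat.of A L) := (IsProjective.iff_projective L).1 inferInstance
  exact subsingleton_of_forall_eq 0 fun e => Abelian.Ext.eq_zero_of_projective e

theorem Module.injective_iff_hasInjectiveDimensionLT_one (N : Type u) [AddCommGroup N]
    [Module A N] :
    Module.Injective A N ↔ HasInjectiveDimensionLT (ModuleCat.of A N) 1 := by
  rw [Module.injective_iff_injective_object]
  exact CategoryTheory.injective_iff_hasInjectiveDimensionLT_one (X := ModuleCat.of A N)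

theorem hasInjectiveDimensionLT_cosyzygy_iff [hY : Module.Injective A Y]
    (hf : Function.Injective f) (hfg : Function.Exact f g) (hg : Function.Surjective g) (n : ℕ) :
    HasInjectiveDimensionLT (ModuleCat.of A Z) (n + 1) ↔
      HasInjectiveDimensionLT (ModuleCat.of A X) (n + 2) := by
  obtain ⟨w, hS⟩ := exists_shortExact_of_exact hf hfg hg
  exact hS.hasInjectiveDimensionLT_X₃_iff n ((Module.injective_iff_injective_object A Y).1 hY)

end ExtTools

/-! ### Cosyzygies of an injective resolution -/

section Cosyzygies

variable {A : Type u} [CommRing A] (C I : ℕ → Type u) [∀ j, AddCommGroup (C j)]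
  [∀ j, Module A (C j)] [∀ j, AddCommGroup (I j)] [∀ j, Module A (I j)]

/-- The exact sequences `0 → C j → I j → C (j + 1) → 0` with `I j` injective obtained from an
injective resolution of `C 0`. -/
structure IsCosyzygySequence (f : ∀ j, C j →ₗ[A] I j) (g : ∀ j, I j →ₗ[A] C (j + 1)) :
    Prop where
  injective : ∀ j, Module.Injective A (I j)
  mono : ∀ j, Function.Injective (f j)
  exact : ∀ j, Function.Exact (f j) (g j)
  epi : ∀ j, Function.Surjective (g j)

namespace IsCosyzygySequence

variable {C I} {f : ∀ j, C j →ₗ[A] I j} {g : ∀ j, I j →ₗ[A] C (j + 1)}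

theorem hasInjectiveDimensionLT_iff (h : IsCosyzygySequence C I f g) (n j : ℕ) :
    HasInjectiveDimensionLT (ModuleCat.of A (C 0)) (n + j + 1) ↔
      HasInjectiveDimensionLT (ModuleCat.of A (C j)) (n + 1) := by
  induction j generalizing n with
  | zero => rfl
  | succ j ih =>
    have := h.injective j
    rw [hasInjectiveDimensionLT_cosyzygy_iff (h.mono j) (h.exact j) (h.epi j),
      show n + (j + 1) + 1 = (n + 1) + j + 1 by omega, ih]

theorem injective_of_hasInjectiveDimensionLT (h : IsCosyzygySequence C I f g) {n j : ℕ}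
    (hn : HasInjectiveDimensionLT (ModuleCat.of A (C 0)) (n + 1)) (hj : n ≤ j) :
    Module.Injective A (C j) := by
  rw [Module.injective_iff_hasInjectiveDimensionLT_one, ← h.hasInjectiveDimensionLT_iff 0 j]
  exact hasInjectiveDimensionLT_of_ge _ (n + 1) _ (by omega)

theorem hasInjectiveDimensionLT_of_injective (h : IsCosyzygySequence C I f g) {j : ℕ}
    (hj : Module.Injective A (C j)) :
    HasInjectiveDimensionLT (ModuleCat.of A (C 0)) (j + 1) := by
  rw [Module.injective_iff_hasInjectiveDimensionLT_one, ← h.hasInjectiveDimensionLT_iff 0 j] at hj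
  rwa [zero_add] at hj

theorem subsingleton_ext (h : IsCosyzygySequence C I f g) {L : Type u} [AddCommGroup L]
    [Module A L] (n j : ℕ)
    (hL : Subsingleton (Abelian.Ext (ModuleCat.of A L) (ModuleCat.of A (C 0)) (n + j + 1))) :
    Subsingleton (Abelian.Ext (ModuleCat.of A L) (ModuleCat.of A (C j)) (n + 1)) := by
  induction j generalizing n with
  | zero => exact hL
  | succ j ih =>
    have := h.injective j
    refine subsingleton_ext_cosyzygy (h.mono j) (h.exact j) (h.epi j) L (ih (n + 1) ?_)
    rwa [show n + 1 + j + 1 = n + (j + 1) + 1 by omega]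

/-- The Noetherian hypothesis is what keeps the localized terms injective. -/
theorem localizedModule [IsNoetherianRing A] (h : IsCosyzygySequence C I f g) (S : Submonoid A) :
    IsCosyzygySequence (A := Localization S) (fun j => LocalizedModule S (C j))
      (fun j => LocalizedModule S (I j)) (fun j => LocalizedModule.map S (f j))
      (fun j => LocalizedModule.map S (g j)) where
  injective j := by
    have := h.injective j
    exact Module.injective_of_isLocalizedModule S (LocalizedModule.mkLinearMap S (I j))
  mono j := LocalizedModule.map_injective S _ (h.mono j)
  exact j := LocalizedModule.map_exact S _ _ (h.exact j)
  epi j := LocalizedModule.map_surjective S _ (h.epi j)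

end IsCosyzygySequence

end Cosyzygies

/-! ### Essential extensions and minimal injective resolutions -/

section Essential

variable {R : Type u} [CommRing R]

/-- A linear map with essential range. -/
def LinearMap.HasEssentialRange {C I : Type*} [AddCommGroup C] [Module R C] [AddCommGroup I]
    [Module R I] (f : C →ₗ[R] I) : Prop :=
  ∀ K : Submodule R I, K ⊓ LinearMap.range f = ⊥ → K = ⊥

theorem LinearMap.HasEssentialRange.exists_smul_eq {C I : Type*} [AddCommGroup C] [Module R C]
    [AddCommGroup I] [Module R I] {f : C →ₗ[R] I} (h : f.HasEssentialRange) {y : I}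
    (hy : y ≠ 0) : ∃ (r : R) (c : C), r • y = f c ∧ r • y ≠ 0 := by
  by_contra! H
  have := h (Submodule.span R {y}) (by
    rw [eq_bot_iff]
    rintro _ ⟨hx, c, rfl⟩
    obtain ⟨r, hr⟩ := Submodule.mem_span_singleton.1 hx
    rw [Submodule.mem_bot, ← hr]
    exact H r c hr)
  exact hy (Submodule.span_singleton_eq_bot.1 this)

/-- The embedding of a module in its injective hull. -/
noncomputable def injectiveHullEmbedding (R : Type u) [CommRing R] (N : Type u) [AddCommGroup N]
    [Module R N] : N →ₗ[R] injectiveHull R N :=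
  (isInjectiveHull_injectiveHull R N).2.choose

variable (R) in
theorem injectiveHullEmbedding_injective (N : Type u) [AddCommGroup N] [Module R N] :
    Function.Injective (injectiveHullEmbedding R N) :=
  (isInjectiveHull_injectiveHull R N).2.choose_spec.1

variable (R) in
theorem hasEssentialRange_injectiveHullEmbedding (N : Type u) [AddCommGroup N] [Module R N] :
    (injectiveHullEmbedding R N).HasEssentialRange :=
  (isInjectiveHull_injectiveHull R N).2.choose_spec.2

/-- The cosyzygies in the minimal injective resolution of a module. -/
noncomputable def minimalCosyzygy (N : ModuleCat.{u} R) : ℕ → ModuleCat.{u} R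
  | 0 => N
  | j + 1 => ModuleCat.of R (injectiveHull R (minimalCosyzygy N j) ⧸
      LinearMap.range (injectiveHullEmbedding R (minimalCosyzygy N j)))

/-- The projection from a term of the minimal injective resolution to the next cosyzygy. -/
noncomputable def minimalCosyzygyMk (N : ModuleCat.{u} R) (j : ℕ) :
    injectiveHull R (minimalCosyzygy N j) →ₗ[R] minimalCosyzygy N (j + 1) :=
  (LinearMap.range (injectiveHullEmbedding R (minimalCosyzygy N j))).mkQ

theorem isCosyzygySequence_minimalCosyzygy (N : ModuleCat.{u} R) :
    IsCosyzygySequence (fun j => minimalCosyzygy N j)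
      (fun j => injectiveHull R (minimalCosyzygy N j))
      (fun j => injectiveHullEmbedding R (minimalCosyzygy N j)) (minimalCosyzygyMk N) where
  injective _ := (isInjectiveHull_injectiveHull R _).1
  mono _ := injectiveHullEmbedding_injective R _
  exact _ := LinearMap.exact_map_mkQ_range _
  epi _ := Submodule.mkQ_surjective _

/-- The product of the multipliers belonging to finitely many generators of `q` works for all of
`q`, and it avoids `q` because `q` is prime. -/
theorem Ideal.FG.exists_notMem_smul_smul_eq_zero {q : Ideal R} [q.IsPrime] (hq : q.FG)
    {I : Type*} [AddCommGroup I] [Module R I] {y : I}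
    (h : ∀ r ∈ q, ∃ u ∉ q, u • r • y = 0) : ∃ v ∉ q, ∀ r ∈ q, v • r • y = 0 := by
  classical
  obtain ⟨T, hT⟩ := hq
  have hTq : ∀ r ∈ T, r ∈ q := fun r hr => hT ▸ Ideal.subset_span hr
  choose! u hu hu0 using h
  refine ⟨∏ r ∈ T, u r, fun hmem => ?_, fun r hr => ?_⟩
  · obtain ⟨r, hr, hr'⟩ := (Ideal.IsPrime.prod_mem_iff (p := q)).1 hmem
    exact hu r (hTq r hr) hr'
  · have : q ≤ LinearMap.ker ((LinearMap.toSpanSingleton R I ((∏ r ∈ T, u r) • y))) := by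
      rw [← hT]
      refine Submodule.span_le.2 fun r hr => ?_
      simp only [SetLike.mem_coe, LinearMap.mem_ker, LinearMap.toSpanSingleton_apply]
      rw [← Finset.prod_erase_mul T u hr, smul_comm, mul_smul, hu0 r (hTq r hr), smul_zero]
    have := this hr
    rw [LinearMap.mem_ker, LinearMap.toSpanSingleton_apply] at this
    rwa [smul_comm]

open IsLocalRing in
/-- If `C → I` is an essential extension and `q` is associated to `D = I / C`, then
`Hom(κ(q), I_q) → Hom(κ(q), D_q)` is not surjective. -/
theorem exists_residueField_hom_not_lift [IsNoetherianRing R] {C I D : Type u} [AddCommGroup C]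
    [Module R C] [AddCommGroup I] [Module R I] [AddCommGroup D] [Module R D] {f : C →ₗ[R] I}
    {g : I →ₗ[R] D} (hess : f.HasEssentialRange) (hfg : Function.Exact f g)
    {q : Ideal R} [q.IsPrime] (hq : IsAssociatedPrime q D) :
    ∃ φ : ResidueField (Localization.AtPrime q) →ₗ[Localization.AtPrime q]
        LocalizedModule q.primeCompl D,
      ¬ ∃ ψ : ResidueField (Localization.AtPrime q) →ₗ[Localization.AtPrime q]
        LocalizedModule q.primeCompl I, LocalizedModule.map q.primeCompl g ∘ₗ ψ = φ := by
  obtain ⟨-, c, hc⟩ := isAssociatedPrime_iff.1 hq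
  have hc' : ∀ r, r ∈ q ↔ r • c = 0 := fun r => by
    conv_lhs => rw [hc]
    simp [Submodule.mem_colon_singleton]
  have hle : maximalIdeal (Localization.AtPrime q) ≤ LinearMap.ker
      (LinearMap.toSpanSingleton (Localization.AtPrime q) (LocalizedModule q.primeCompl D)
        (LocalizedModule.mk c 1)) := by
    intro a ha
    obtain ⟨r, s, rfl⟩ := IsLocalization.exists_mk'_eq q.primeCompl a
    rw [IsLocalization.AtPrime.mk'_mem_maximal_iff _ q] at ha
    rw [LinearMap.mem_ker, LinearMap.toSpanSingleton_apply, ← Localization.mk_eq_mk',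
      LocalizedModule.mk_smul_mk, (hc' r).1 ha, LocalizedModule.zero_mk]
  -- The map sends `1` to `c / 1`, where `q` is the annihilator of `c`. If it lifts, with `1` going
  -- to `y / s`, some multiple of `y` by an element outside `q` is killed by `q`. By essentiality
  -- this has a nonzero multiple in `C`, with multiplier outside `q`. Its image in `D` is zero, yet
  -- it is a multiple of `c` by an element outside `q`.
  refine ⟨Submodule.liftQ _ _ hle, ?_⟩
  rintro ⟨ψ, hψ⟩
  obtain ⟨y, s, hy⟩ : ∃ (y : I) (s : q.primeCompl), ψ 1 = LocalizedModule.mk y s := by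
    induction h : ψ 1 using LocalizedModule.induction_on with
    | h m s => exact ⟨m, s, rfl⟩
  have h1 : LocalizedModule.mk (g y) s = LocalizedModule.mk c 1 := by
    have := LinearMap.congr_fun hψ 1
    rw [LinearMap.comp_apply, hy, LocalizedModule.map_mk] at this
    rw [this]
    change Submodule.liftQ _ _ hle (Submodule.Quotient.mk 1) = _
    rw [Submodule.liftQ_apply, LinearMap.toSpanSingleton_apply, one_smul]
  obtain ⟨u, hu⟩ := LocalizedModule.mk_eq.1 h1
  have h2 : ∀ r ∈ q, ∃ v ∉ q, v • r • y = 0 := by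
    intro r hr
    have h3 : algebraMap R (Localization.AtPrime q) r • ψ 1 = 0 := by
      rw [← map_smul]
      have : algebraMap R (Localization.AtPrime q) r •
          (1 : ResidueField (Localization.AtPrime q)) = 0 := by
        rw [Algebra.smul_def, mul_one]
        exact (residue_eq_zero_iff _).2 ((IsLocalization.AtPrime.to_map_mem_maximal_iff _ q r).2 hr)
      rw [this, map_zero]
    rw [hy, algebraMap_smul, LocalizedModule.smul'_mk] at h3
    rw [← LocalizedModule.zero_mk s] at h3
    obtain ⟨v, hv⟩ := LocalizedModule.mk_eq.1 h3
    refine ⟨v * s, (v * s).2, ?_⟩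
    simpa [Submonoid.smul_def, mul_smul] using hv
  obtain ⟨v, hv, hvq⟩ := Ideal.FG.exists_notMem_smul_smul_eq_zero (IsNoetherian.noetherian q) h2
  have hw : (u : R) * v * s ∉ q := (u * (⟨v, hv⟩ : q.primeCompl) * s).2
  have hgy : g (((u : R) * v) • y) = ((u : R) * v * s) • c := by
    have hu' : (u : R) • g y = (u : R) • (s : R) • c := by
      simpa [Submonoid.smul_def] using hu
    rw [map_smul, mul_comm, mul_smul, hu', mul_assoc, mul_smul, mul_smul, smul_comm]
  have hne : ((u : R) * v) • y ≠ 0 := fun h0 => hw ((hc' _).2 (by rw [← hgy, h0, map_zero]))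
  obtain ⟨r, c0, hr, hr0⟩ := hess.exists_smul_eq hne
  have hrq : r ∉ q := fun hrq => hr0 (by
    rw [mul_smul, smul_comm, smul_comm r v, hvq r hrq, smul_zero])
  have hg0 : (r * ((u : R) * v * s)) • c = 0 := by
    rw [mul_smul, ← hgy, ← map_smul, hr, hfg.apply_apply_eq_zero]
  exact ((inferInstance : q.IsPrime).mem_or_mem ((hc' _).2 hg0)).elim hrq hw

end Essential

/-! ### Finite injective dimension is bounded by the Krull dimension -/

section InjectiveDimensionBound

open IsLocalRing

/-- If the residue field embeds in `L`, then `Ext^n(L, N)` maps onto `Ext^n(k, N)`, because degree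
`n + 1` vanishes. Otherwise there is an `L`-regular element `y` of the maximal ideal; passing to `L
/ yL` lowers the dimension by one and raises the first degree of assumed vanishing by one. The
dimension bounds the number of such steps. -/
theorem subsingleton_ext_residueField {A : Type u} [CommRing A] [IsLocalRing A]
    [IsNoetherianRing A] (N : Type u) [AddCommGroup N] [Module A N] {n : ℕ}
    (hN : HasInjectiveDimensionLT (ModuleCat.of A N) (n + 1)) (e : ℕ) (he : e < n) (L : Type u)
    [AddCommGroup L] [Module A L] [Module.Finite A L] [Nontrivial L]
    (hL : Module.supportDim A L ≤ e)
    (hExt : ∀ i, n ≤ i + e → Subsingleton (Abelian.Ext (ModuleCat.of A L) (ModuleCat.of A N) i)) :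
    Subsingleton (Abelian.Ext (ModuleCat.of A (ResidueField A)) (ModuleCat.of A N) n) := by
  have htop : ∀ X : ModuleCat.{u} A, Subsingleton (Abelian.Ext X (ModuleCat.of A N) (n + 1)) :=
    fun X => HasInjectiveDimensionLT.subsingleton _ (n + 1) _ le_rfl X
  have key : ∀ (L : Type u) [AddCommGroup L] [Module A L],
      Subsingleton (Abelian.Ext (ModuleCat.of A L) (ModuleCat.of A N) n) →
      ¬ Subsingleton (ResidueField A →ₗ[A] L) →
      Subsingleton (Abelian.Ext (ModuleCat.of A (ResidueField A)) (ModuleCat.of A N) n) := by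
    intro L _ _ hn hs
    rw [not_subsingleton_iff_nontrivial] at hs
    obtain ⟨φ, hφ⟩ := exists_ne (0 : ResidueField A →ₗ[A] L)
    have hinj : Function.Injective φ := by
      refine (injective_iff_map_eq_zero φ).2 fun x hx => ?_
      by_contra hx0
      refine hφ (LinearMap.ext fun y => ?_)
      obtain ⟨a, ha⟩ := residue_surjective (y / x)
      have : y = a • x := by
        rw [Algebra.smul_def, ResidueField.algebraMap_eq, ha, div_mul_cancel₀ _ hx0]
      rw [this, map_smul, hx, smul_zero, LinearMap.zero_apply]
    exact subsingleton_ext_first hinj (LinearMap.exact_map_mkQ_range φ)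
      (Submodule.mkQ_surjective _) N hn (htop _)
  have step : ∀ (L : Type u) [AddCommGroup L] [Module A L] [Module.Finite A L] [Nontrivial L],
      Subsingleton (ResidueField A →ₗ[A] L) → ∃ y ∈ maximalIdeal A, IsSMulRegular L y ∧
        Nontrivial (QuotSMulTop y L) ∧
        Module.supportDim A (QuotSMulTop y L) + 1 = Module.supportDim A L := by
    intro L _ _ _ _ hs
    obtain ⟨y, hy, hreg⟩ := IsSMulRegular.subsingleton_linearMap_iff.1 hs
    have hym : y ∈ maximalIdeal A := by
      have := Module.mem_annihilator.1 hy 1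
      rwa [Algebra.smul_def, mul_one, ResidueField.algebraMap_eq, residue_eq_zero_iff] at this
    exact ⟨y, hym, hreg, nontrivial_quotSMulTop_of_mem_maximalIdeal L hym,
      Module.supportDim_quotSMulTop_succ_eq_supportDim hreg hym⟩
  induction e generalizing L with
  | zero =>
    by_cases hs : Subsingleton (ResidueField A →ₗ[A] L)
    · obtain ⟨y, -, -, hnt, hdim⟩ := step L hs
      rw [← hdim] at hL
      obtain ⟨m, hm⟩ := WithBot.ne_bot_iff_exists.1
        (Module.supportDim_ne_bot_of_nontrivial A (QuotSMulTop y L))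
      rw [← hm] at hL
      have : m + 1 ≤ 0 := by exact_mod_cast hL
      simp at this
    · exact key L (hExt n (by omega)) hs
  | succ e ih =>
    by_cases hs : Subsingleton (ResidueField A →ₗ[A] L)
    · obtain ⟨y, -, hreg, hnt, hdim⟩ := step L hs
      refine ih (by omega) (QuotSMulTop y L) ?_ ?_
      · rw [← hdim] at hL
        obtain ⟨m, hm⟩ := WithBot.ne_bot_iff_exists.1
          (Module.supportDim_ne_bot_of_nontrivial A (QuotSMulTop y L))
        rw [← hm] at hL ⊢
        have : m + 1 ≤ e + 1 := by exact_mod_cast hL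
        have : m ≤ e := by simpa using this
        exact_mod_cast this
      · intro i hi
        have hexact := LinearMap.exact_lsmul_mkQ_smul_top L y
        rcases i with _ | i
        · omega
        exact subsingleton_ext_third (f := LinearMap.lsmul A L y) hreg hexact
          (Submodule.mkQ_surjective _) N (hExt i (by omega)) (hExt (i + 1) (by omega))
    · exact key L (hExt n (by omega)) hs

theorem ringKrullDim_localization_atPrime_le {R : Type u} [CommRing R] (q : Ideal R) [q.IsPrime] :
    ringKrullDim (Localization.AtPrime q) ≤ ringKrullDim R := by
  rw [IsLocalization.AtPrime.ringKrullDim_eq_height q]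
  exact Ideal.height_le_ringKrullDim_of_ne_top (Ideal.IsPrime.ne_top inferInstance)

/-- Over a Noetherian ring of dimension at most `d`, finite injective dimension is at most `d`. -/
theorem hasInjectiveDimensionLT_of_ringKrullDim_le {R : Type u} [CommRing R] [IsNoetherianRing R]
    {d : ℕ} (hd : ringKrullDim R ≤ d) (N : ModuleCat.{u} R) {n : ℕ}
    (hN : HasInjectiveDimensionLT N (n + 1)) : HasInjectiveDimensionLT N (d + 1) := by
  induction n with
  | zero => exact hasInjectiveDimensionLT_of_ge N 1 _ (by omega)
  | succ n ih =>
    by_cases hnd : n + 1 ≤ d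
    · exact hasInjectiveDimensionLT_of_ge N (n + 1 + 1) _ (by omega)
    refine ih ?_
    have hseq := isCosyzygySequence_minimalCosyzygy N
    refine hseq.hasInjectiveDimensionLT_of_injective (j := n) ?_
    by_cases hD : Subsingleton (minimalCosyzygy N (n + 1))
    · have := hseq.injective n
      have hsurj : Function.Surjective (injectiveHullEmbedding R (minimalCosyzygy N n)) :=
        fun y => (hseq.exact n y).1 (Subsingleton.elim _ _)
      let e := LinearEquiv.ofBijective _ ⟨hseq.mono n, hsurj⟩
      rw [← Module.Baer.iff_injective] at this ⊢
      exact Module.Baer.of_equiv e.symm this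
    -- If the last cosyzygy is nonzero, take an associated prime `q` of it. By minimality some map
    -- from the residue field at `q` does not lift, so its `Ext^(n+1)` into `N_q` is nonzero. But
    -- that group vanishes, as `R_q` is free of dimension at most `d < n + 1`.
    · exfalso
      rw [not_subsingleton_iff_nontrivial] at hD
      obtain ⟨q, hq⟩ := associatedPrimes.nonempty R (minimalCosyzygy N (n + 1))
      have := hq.isPrime
      obtain ⟨φ, hφ⟩ := exists_residueField_hom_not_lift
        (hasEssentialRange_injectiveHullEmbedding R (minimalCosyzygy N n)) (hseq.exact n) hq
      refine hφ ?_
      have hloc := hseq.localizedModule q.primeCompl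
      refine exists_lift_of_subsingleton_ext_one (hloc.mono n) (hloc.exact n) (hloc.epi n) ?_ φ
      refine hloc.subsingleton_ext 0 n ?_
      have hinj : HasInjectiveDimensionLT
          (ModuleCat.of (Localization.AtPrime q) (LocalizedModule q.primeCompl N)) (n + 1 + 1) :=
        ?_
      · rw [show 0 + n + 1 = n + 1 by omega]
        refine subsingleton_ext_residueField _ hinj d (by omega) (Localization.AtPrime q) ?_ ?_
        · rw [Module.supportDim_self_eq_ringKrullDim]
          exact (ringKrullDim_localization_atPrime_le q).trans hd
        · intro i hi
          obtain ⟨i, rfl⟩ : ∃ k, i = k + 1 := ⟨i - 1, by omega⟩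
          exact subsingleton_ext_of_free _ _ i
      · have := hseq.injective_of_hasInjectiveDimensionLT hN le_rfl
        have h2 : Module.Injective (Localization.AtPrime q)
            (LocalizedModule q.primeCompl (minimalCosyzygy N (n + 1))) :=
          Module.injective_of_isLocalizedModule q.primeCompl
            (LocalizedModule.mkLinearMap q.primeCompl _)
        exact hloc.hasInjectiveDimensionLT_of_injective h2

end InjectiveDimensionBound

/-! ### Torsion of cosyzygies away from the maximal ideal -/

section Torsion

variable {R : Type u} [CommRing R] [IsNoetherianRing R]

/-- In an essential extension of `C`, an element whose multiples in `C` vanish at `p` vanishes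
at `p`. -/
theorem LinearMap.HasEssentialRange.exists_notMem_smul_eq_zero {C I : Type*} [AddCommGroup C]
    [Module R C] [AddCommGroup I] [Module R I] {f : C →ₗ[R] I} (hess : f.HasEssentialRange)
    (p : Ideal R) [p.IsPrime] (w : I)
    (h : ∀ (a : R) (c : C), a • w = f c → ∃ u ∉ p, u • a • w = 0) : ∃ u ∉ p, u • w = 0 := by
  -- Choose `u ∉ p` with the annihilator of `u • w` maximal. If `u • w ≠ 0`, a nonzero multiple `b •
  -- u • w` lies in `C` and is killed by some `v ∉ p`, so the annihilator of `(v * u) • w` is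
  -- strictly larger: it contains `b`.
  obtain ⟨J, ⟨u, hu, rfl⟩, hmax⟩ := set_has_maximal_iff_noetherian.2 ‹IsNoetherianRing R›
    {J | ∃ u ∉ p, J = LinearMap.ker (LinearMap.toSpanSingleton R I (u • w))}
    ⟨_, 1, (Ideal.ne_top_iff_one p).1 Ideal.IsPrime.ne_top', rfl⟩
  refine ⟨u, hu, ?_⟩
  by_contra hne
  obtain ⟨b, c, hb, hb0⟩ := hess.exists_smul_eq hne
  obtain ⟨v, hv, hvb⟩ := h (b * u) c (by rw [mul_smul, hb])
  refine hmax _ ⟨v * u, (inferInstance : p.IsPrime).mul_notMem hv hu, rfl⟩ ?_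
  refine lt_of_le_of_ne (fun r hr => ?_) fun heq => hb0 ?_
  · simp only [LinearMap.mem_ker, LinearMap.toSpanSingleton_apply] at hr ⊢
    rw [mul_smul, smul_comm r v, hr, smul_zero]
  · have : b ∈ LinearMap.ker (LinearMap.toSpanSingleton R I ((v * u) • w)) := by
      rw [LinearMap.mem_ker, LinearMap.toSpanSingleton_apply, mul_smul, smul_comm b v,
        ← mul_smul b u, hvb]
    rw [← heq] at this
    simpa using this

/-- Injectivity of `C_p` splits `C_p → I_p` by a retraction `ρ`. Essentiality survives localization,
so `ρ` has zero kernel; hence `C_p = I_p` and `D_p = 0`. -/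
theorem exists_notMem_smul_eq_zero_of_injective {C I D : Type u} [AddCommGroup C] [Module R C]
    [AddCommGroup I] [Module R I] [AddCommGroup D] [Module R D] {f : C →ₗ[R] I} {g : I →ₗ[R] D}
    (hf : Function.Injective f) (hess : f.HasEssentialRange) (hfg : Function.Exact f g)
    (hg : Function.Surjective g) (p : Ideal R) [p.IsPrime]
    (hC : Module.Injective (Localization.AtPrime p) (LocalizedModule p.primeCompl C)) (z : D) :
    ∃ u ∉ p, u • z = 0 := by
  obtain ⟨y, rfl⟩ := hg z
  obtain ⟨ρ, hρ⟩ := hC.out (LocalizedModule.map p.primeCompl f)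
    (LocalizedModule.map_injective _ f hf) LinearMap.id
  obtain ⟨c, s, hc⟩ : ∃ (c : C) (s : p.primeCompl),
      ρ (LocalizedModule.mk y 1) = LocalizedModule.mk c s := by
    induction h : ρ (LocalizedModule.mk y 1) using LocalizedModule.induction_on with
    | h m s => exact ⟨m, s, rfl⟩
  have hρR : ∀ (r : R) x, ρ (r • x) = r • ρ x := fun r x => by
    rw [← algebraMap_smul (Localization.AtPrime p) r x, map_smul, algebraMap_smul]
  have hρf : ∀ c : C, ρ (LocalizedModule.mk (f c) 1) = LocalizedModule.mk c 1 := fun c => by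
    have := hρ (LocalizedModule.mk c 1)
    rwa [LocalizedModule.map_mk] at this
  have hmk : ∀ {X : Type u} [AddCommGroup X] [Module R X] (r : R) (x : X),
      r • (LocalizedModule.mk x 1 : LocalizedModule p.primeCompl X) =
        LocalizedModule.mk (r • x) 1 := fun r x => by rw [LocalizedModule.smul'_mk]
  set w := (s : R) • y - f c with hw
  have hρw : ρ (LocalizedModule.mk w 1) = 0 := by
    have h1 : (LocalizedModule.mk w 1 : LocalizedModule p.primeCompl I) =
        (s : R) • LocalizedModule.mk y 1 - LocalizedModule.mk (f c) 1 := by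
      rw [hmk]
      exact map_sub (LocalizedModule.mkLinearMap p.primeCompl I) _ _
    rw [h1, map_sub, hρR, hc, hρf, LocalizedModule.smul'_mk, ← Submonoid.smul_def,
      LocalizedModule.mk_cancel, sub_self]
  obtain ⟨u, hu, huw⟩ := hess.exists_notMem_smul_eq_zero p w (fun a c' hac => by
    have h2 : (LocalizedModule.mk c' 1 : LocalizedModule p.primeCompl C) =
        LocalizedModule.mk 0 1 := by
      rw [← hρf, ← hac, ← hmk, hρR, hρw, smul_zero, LocalizedModule.zero_mk]
    obtain ⟨v, hv⟩ := LocalizedModule.mk_eq.1 h2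
    refine ⟨v, v.2, ?_⟩
    rw [hac, ← map_smul]
    have : (v : R) • c' = 0 := by simpa [Submonoid.smul_def] using hv
    rw [this, map_zero])
  refine ⟨u * s, (inferInstance : p.IsPrime).mul_notMem hu s.2, ?_⟩
  rw [mul_smul, ← map_smul, ← map_smul]
  have : u • (s : R) • y = f (u • c) := by
    rw [hw, smul_sub, sub_eq_zero] at huw
    rw [huw, map_smul]
  rw [this, hfg.apply_apply_eq_zero]

/-- No prime other than `m` contains the annihilator of `x`, so its radical contains `m`, which is
finitely generated. -/
theorem exists_pow_maximalIdeal_smul_eq_zero [IsLocalRing R] {X : Type*} [AddCommGroup X]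
    [Module R X] (x : X)
    (h : ∀ (p : Ideal R) [p.IsPrime], p ≠ IsLocalRing.maximalIdeal R → ∃ u ∉ p, u • x = 0) :
    ∃ k : ℕ, ∀ r ∈ IsLocalRing.maximalIdeal R ^ k, r • x = 0 := by
  have hrad : IsLocalRing.maximalIdeal R ≤
      Ideal.radical (LinearMap.ker (LinearMap.toSpanSingleton R X x)) := by
    rw [Ideal.radical_eq_sInf]
    refine le_sInf fun p ⟨hle, hp⟩ => ?_
    by_contra hpm
    obtain ⟨u, hu, hux⟩ := h p fun heq => hpm heq.ge
    exact hu (hle (by simpa using hux))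
  obtain ⟨k, hk⟩ := Ideal.exists_pow_le_of_le_radical_of_fg hrad (IsNoetherian.noetherian _)
  exact ⟨k, fun r hr => by simpa using hk hr⟩

end Torsion

/-! ### The evaluation map from `M ⊗ Hom(I, E)` to `Hom(Hom(M, I), E)` -/

section HomTensor

open TensorProduct

variable {R : Type*} [CommRing R] {M I E : Type*} [AddCommGroup M] [Module R M]
  [AddCommGroup I] [Module R I] [AddCommGroup E] [Module R E]

variable (R M I E) in
/-- The natural map `M ⊗ Hom(I, E) → Hom(Hom(M, I), E)`. -/
noncomputable def tensorHomEval : M ⊗[R] (I →ₗ[R] E) →ₗ[R] (M →ₗ[R] I) →ₗ[R] E :=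
  TensorProduct.lift (LinearMap.mk₂ R (fun m φ => φ ∘ₗ LinearMap.applyₗ m)
    (fun _ _ _ => by ext; simp) (fun _ _ _ => by ext; simp) (fun _ _ _ => by ext; simp)
    (fun _ _ _ => by ext; simp))

@[simp]
theorem tensorHomEval_tmul (m : M) (φ : I →ₗ[R] E) (g : M →ₗ[R] I) :
    tensorHomEval R M I E (m ⊗ₜ φ) g = φ (g m) := rfl

theorem tensorHomEval_rTensor {M' : Type*} [AddCommGroup M'] [Module R M'] (h : M →ₗ[R] M')
    (z : M ⊗[R] (I →ₗ[R] E)) (g : M' →ₗ[R] I) :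
    tensorHomEval R M' I E (h.rTensor _ z) g = tensorHomEval R M I E z (g ∘ₗ h) := by
  induction z with
  | zero => simp
  | add x y hx hy => simp [hx, hy]
  | tmul m φ => simp

theorem tensorHomEval_lTensor {I' : Type*} [AddCommGroup I'] [Module R I'] (h : I →ₗ[R] I')
    (z : M ⊗[R] (I' →ₗ[R] E)) (g : M →ₗ[R] I) :
    tensorHomEval R M I E ((LinearMap.lcomp R E h).lTensor M z) g =
      tensorHomEval R M I' E z (h ∘ₗ g) := by
  induction z with
  | zero => simp
  | add x y hx hy => simp [hx, hy]
  | tmul m φ => simp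

end HomTensor

theorem Module.Injective.exists_comp_eq {R : Type u} [CommRing R] {E : Type u} [AddCommGroup E]
    [Module R E] (hE : Module.Injective R E) {X Y : Type u} [AddCommGroup X] [Module R X]
    [AddCommGroup Y] [Module R Y] (α : X →ₗ[R] Y) (φ : X →ₗ[R] E)
    (h : LinearMap.ker α ≤ LinearMap.ker φ) : ∃ ψ : Y →ₗ[R] E, ψ ∘ₗ α = φ := by
  obtain ⟨ψ, hψ⟩ := hE.out ((LinearMap.ker α).liftQ α le_rfl)
    (LinearMap.ker_eq_bot.1 (Submodule.ker_liftQ_eq_bot' _ _ rfl)) ((LinearMap.ker α).liftQ φ h)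
  exact ⟨ψ, LinearMap.ext fun x => hψ (Submodule.Quotient.mk x)⟩

/-! ### Injectivity of the evaluation map, and flatness of `Hom(I, E)` -/

section HomTensorInjective

open TensorProduct

variable {R : Type u} [CommRing R] [IsNoetherianRing R] {I E : Type u}
  [AddCommGroup I] [Module R I] [AddCommGroup E] [Module R E]

/-- In a presentation `R^m → R^n → M → 0`, `Hom(M, I)` is the kernel of `α : I^n → I^m`. A tensor is
given by a map `I^n → E`; if it evaluates to zero, this map vanishes on `ker α` and so factors
through `α`, because `E` is injective. The factorization rewrites the tensor in terms of the
relations of `M`, which are zero. -/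
theorem tensorHomEval_injective (M : Type u) [AddCommGroup M] [Module R M] [Module.Finite R M]
    (hE : Module.Injective R E) : Function.Injective (tensorHomEval R M I E) := by
  refine (injective_iff_map_eq_zero _).2 fun z hz => ?_
  obtain ⟨n, p, hp⟩ := Module.Finite.exists_fin' R M
  obtain ⟨m, κ, hκ⟩ := Module.Finite.exists_fin' R (LinearMap.ker p)
  have hsum : ∀ v : Fin n → R, ∑ i, v i • p (Pi.single i 1) = p v := fun v => by
    conv_rhs => rw [← Finset.univ_sum_single v, map_sum]
    simp_rw [← map_smul, ← Pi.single_smul, smul_eq_mul, mul_one]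
  obtain ⟨φ, rfl⟩ : ∃ φ : Fin n → (I →ₗ[R] E), z = ∑ i, p (Pi.single i 1) ⊗ₜ[R] φ i := by
    clear hz
    induction z with
    | zero => exact ⟨0, by simp⟩
    | add x y hx hy =>
      obtain ⟨φ, rfl⟩ := hx
      obtain ⟨φ', rfl⟩ := hy
      exact ⟨φ + φ', by simp [TensorProduct.tmul_add, Finset.sum_add_distrib]⟩
    | tmul x ψ =>
      obtain ⟨v, rfl⟩ := hp x
      refine ⟨fun i => v i • ψ, ?_⟩
      simp_rw [← TensorProduct.smul_tmul, ← TensorProduct.sum_tmul, hsum]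
  set k : Fin m → Fin n → R := fun j => (κ (Pi.single j 1) : Fin n → R) with hk
  have hpk : ∀ j, ∑ i, k j i • p (Pi.single i 1) = 0 := fun j => by
    rw [hsum]
    exact (κ (Pi.single j 1)).2
  have hκsum : ∀ (a : Fin m → R), (κ a : Fin n → R) = ∑ j, a j • k j := fun a => by
    conv_lhs => rw [← Finset.univ_sum_single a, map_sum, Submodule.coe_sum]
    simp_rw [hk, ← Submodule.coe_smul, ← map_smul, ← Pi.single_smul, smul_eq_mul, mul_one]
  set α : (Fin n → I) →ₗ[R] (Fin m → I) :=
    LinearMap.pi fun j => ∑ i, k j i • LinearMap.proj i with hα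
  obtain ⟨ψ, hψ⟩ := hE.exists_comp_eq α (∑ i, φ i ∘ₗ LinearMap.proj i) (by
    intro v hv
    have hv' : ∀ j, ∑ i, k j i • v i = 0 := fun j => by
      simpa [hα] using congrFun (LinearMap.mem_ker.1 hv) j
    have hker : LinearMap.ker p ≤ LinearMap.ker (Fintype.linearCombination R v) := by
      intro a ha
      obtain ⟨b, hb⟩ := hκ ⟨a, ha⟩
      have hab : a = ∑ j, b j • k j := by rw [← hκsum, hb]
      rw [LinearMap.mem_ker, hab, map_sum]
      refine Finset.sum_eq_zero fun j _ => ?_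
      rw [map_smul, Fintype.linearCombination_apply, hv', smul_zero]
    let g : M →ₗ[R] I := (LinearMap.ker p).liftQ _ hker ∘ₗ
      (LinearMap.quotKerEquivOfSurjective p hp).symm
    have hg : ∀ a, g (p a) = Fintype.linearCombination R v a := fun a => by
      have : (LinearMap.quotKerEquivOfSurjective p hp).symm (p a) = Submodule.Quotient.mk a := by
        rw [LinearEquiv.symm_apply_eq]
        rfl
      simp [g, this]
    have := LinearMap.congr_fun hz g
    simpa [hg, Fintype.linearCombination_apply_single] using this)
  have hφ : ∀ i, φ i = ∑ j, k j i • (ψ ∘ₗ LinearMap.single R (fun _ => I) j) := by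
    intro i
    ext y
    have h1 := LinearMap.congr_fun hψ (Pi.single i y)
    have h2 : α (Pi.single i y) = ∑ j, Pi.single j (k j i • y) := by
      rw [Finset.univ_sum_single]
      ext j
      simp [hα, Pi.single_apply]
    have h3 : ∑ j, ψ (Pi.single j (k j i • y)) = φ i y := by
      rw [← map_sum, ← h2]
      simpa [Pi.single_apply, apply_ite] using h1
    rw [← h3]
    simp [Pi.single_smul]
  calc ∑ i, p (Pi.single i 1) ⊗ₜ[R] φ i
      = ∑ j, (∑ i, k j i • p (Pi.single i 1)) ⊗ₜ[R] (ψ ∘ₗ LinearMap.single R (fun _ => I) j) := by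
        simp_rw [hφ, TensorProduct.tmul_sum, TensorProduct.sum_tmul, TensorProduct.smul_tmul]
        rw [Finset.sum_comm]
    _ = 0 := by simp [hpk]

/-- For `I` and `E` injective over a Noetherian ring, `Hom(I, E)` is flat. -/
theorem flat_linearMap_of_injective (hI : Module.Injective R I) (hE : Module.Injective R E) :
    Module.Flat R (I →ₗ[R] E) := by
  -- Since `I` is injective, every map `J → I` extends to `R`; so an element of `J ⊗ Hom(I, E)`
  -- dying in `R ⊗ Hom(I, E)` evaluates to zero on `Hom(J, I)`.
  refine Module.Flat.iff_rTensor_injective'.2 fun J => ?_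
  refine (injective_iff_map_eq_zero _).2 fun z hz => ?_
  refine tensorHomEval_injective J hE (LinearMap.ext fun g => ?_)
  obtain ⟨g', hg'⟩ := hI.out J.subtype J.injective_subtype g
  have : g = g' ∘ₗ J.subtype := LinearMap.ext fun x => (hg' x).symm
  rw [this, ← tensorHomEval_rTensor, hz]
  simp

end HomTensorInjective

/-! ### Flat dimension via character modules -/

section FlatDimension

theorem CharacterModule.exact_dual {A X Y Z : Type*} [CommRing A] [AddCommGroup X] [Module A X]
    [AddCommGroup Y] [Module A Y] [AddCommGroup Z] [Module A Z] {f : X →ₗ[A] Y} {g : Y →ₗ[A] Z}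
    (hfg : Function.Exact f g) (hg : Function.Surjective g) :
    Function.Exact (CharacterModule.dual g) (CharacterModule.dual f) := by
  intro c
  constructor
  · intro hc
    have hle : g.toAddMonoidHom.ker ≤ AddMonoidHom.ker (G := Y) c := by
      intro y hy
      obtain ⟨x, rfl⟩ := (hfg y).1 hy
      exact DFunLike.congr_fun hc x
    refine ⟨g.toAddMonoidHom.liftOfSurjective hg ⟨c, hle⟩, ?_⟩
    ext y
    exact AddMonoidHom.liftOfRightInverse_comp_apply _ _
      (Function.rightInverse_surjInv hg) ⟨c, hle⟩ y
  · rintro ⟨c, rfl⟩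
    ext x
    change c (g (f x)) = 0
    rw [hfg.apply_apply_eq_zero, map_zero]

variable {A : Type u} [CommRing A]

theorem Module.Flat.injective_characterModule (X : Type u) [AddCommGroup X] [Module A X]
    [Module.Flat A X] : Module.Injective A (CharacterModule X) :=
  Module.Flat.iff_characterModule_injective.1 inferInstance

/-- Character duality is exact and turns flat modules into injective ones, so it turns a flat
resolution into an injective resolution of the same length. -/
theorem HasFlatDimensionLE.hasInjectiveDimensionLT_characterModule {n : ℕ} {X : Type u}
    [AddCommGroup X] [Module A X] (h : HasFlatDimensionLE A X n) :
    HasInjectiveDimensionLT (ModuleCat.of A (CharacterModule X)) (n + 1) := by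
  induction n generalizing X with
  | zero =>
    obtain ⟨F, δ, ε, hF, hF0, hε, hδε, -⟩ := h
    rw [← Module.injective_iff_hasInjectiveDimensionLT_one,
      ← Module.Flat.iff_characterModule_injective]
    have := hF 0
    have hinj : Function.Injective ε := by
      refine (injective_iff_map_eq_zero ε).2 fun x hx => ?_
      obtain ⟨y, rfl⟩ := (hδε x).1 hx
      have := hF0 1 one_pos
      rw [Subsingleton.elim y 0, map_zero]
    exact Module.Flat.of_linearEquiv (LinearEquiv.ofBijective ε ⟨hinj, hε⟩).symm
  | succ n ih =>
    obtain ⟨F, δ, ε, hF, hF0, hε, hδε, hδ⟩ := h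
    have hδK : ∀ x, δ 0 x ∈ LinearMap.ker ε := fun x => hδε.apply_apply_eq_zero x
    have hK : HasFlatDimensionLE A (LinearMap.ker ε) n := by
      refine ⟨fun i => F (i + 1), fun i => δ (i + 1), (δ 0).codRestrict _ hδK, fun i => hF _,
        fun i hi => hF0 _ (by omega), ?_, ?_, fun i => hδ (i + 1)⟩
      · rintro ⟨x, hx⟩
        obtain ⟨y, rfl⟩ := (hδε x).1 hx
        exact ⟨y, rfl⟩
      · intro x
        rw [← hδ 0 x]
        exact Subtype.ext_iff
    have := hF 0
    have := Module.Flat.injective_characterModule (A := A) (F 0)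
    have hex : Function.Exact (LinearMap.ker ε).subtype ε := ε.exact_subtype_ker_map
    exact (hasInjectiveDimensionLT_cosyzygy_iff
      (CharacterModule.dual_injective_of_surjective ε hε) (CharacterModule.exact_dual hex hε)
      (CharacterModule.dual_surjective_of_injective _ (LinearMap.ker ε).injective_subtype) n).1
      (ih hK)

/-- Over a Noetherian ring of dimension at most `d`, all flat syzygies from the `d`-th on of a
module of finite flat dimension are flat. -/
theorem flat_syzygy_of_hasFlatDimensionLE [IsNoetherianRing A] {d : ℕ} (hd : ringKrullDim A ≤ d)
    {X F : ℕ → Type u} [∀ j, AddCommGroup (X j)] [∀ j, Module A (X j)] [∀ j, AddCommGroup (F j)]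
    [∀ j, Module A (F j)] {a : ∀ j, X (j + 1) →ₗ[A] F j} {b : ∀ j, F j →ₗ[A] X j}
    (hF : ∀ j, Module.Flat A (F j)) (ha : ∀ j, Function.Injective (a j))
    (hab : ∀ j, Function.Exact (a j) (b j)) (hb : ∀ j, Function.Surjective (b j)) {n : ℕ}
    (hX : HasFlatDimensionLE A (X 0) n) {j : ℕ} (hj : d ≤ j) : Module.Flat A (X j) := by
  -- Dualizing makes the syzygies cosyzygies, to which the bound on injective dimension applies;
  -- injectivity of the character module then gives back flatness.
  have hseq : IsCosyzygySequence (fun j => CharacterModule (X j)) (fun j => CharacterModule (F j))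
      (fun j => CharacterModule.dual (b j)) (fun j => CharacterModule.dual (a j)) :=
    { injective := fun j => Module.Flat.injective_characterModule (F j)
      mono := fun j => CharacterModule.dual_injective_of_surjective _ (hb j)
      exact := fun j => CharacterModule.exact_dual (hab j) (hb j)
      epi := fun j => CharacterModule.dual_surjective_of_injective _ (ha j) }
  rw [Module.Flat.iff_characterModule_injective]
  exact hseq.injective_of_hasInjectiveDimensionLT (hasInjectiveDimensionLT_of_ringKrullDim_le hd _
    hX.hasInjectiveDimensionLT_characterModule) hj

end FlatDimension

/-! ### Maps from `M` into a torsion essential extension -/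

section Ulrich

open Pointwise

open IsLocalRing

/-- By integrality every prime of `S` over `m` is maximal, so the radical of `mS` is the maximal
ideal of `S`. -/
theorem exists_pow_mem_map_maximalIdeal {R : Type u} {S : Type v} [CommRing R] [IsLocalRing R]
    [CommRing S] [IsLocalRing S] [Algebra R S] [Module.Finite R S] {x : S}
    (hx : x ∈ maximalIdeal S) : ∃ n : ℕ, x ^ n ∈ (maximalIdeal R).map (algebraMap R S) := by
  rw [← Ideal.mem_radical_iff, Ideal.radical_eq_sInf, Ideal.mem_sInf]
  rintro P ⟨hle, hP⟩
  have : P.comap (algebraMap R S) = maximalIdeal R :=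
    ((maximalIdeal.isMaximal R).eq_of_le (Ideal.IsPrime.ne_top inferInstance)
      (Ideal.map_le_iff_le_comap.1 hle)).symm
  have hmax : P.IsMaximal := Ideal.isMaximal_of_isIntegral_of_isMaximal_comap P
    (this ▸ maximalIdeal.isMaximal R)
  rwa [eq_maximalIdeal hmax]

theorem map_smul_eq_zero_of_mem_pow_map {R S : Type*} [CommRing R] [CommRing S] [Algebra R S]
    {M : Type*} [AddCommGroup M] [Module R M] [Module S M]
    [IsScalarTower R S M] {I : Type*} [AddCommGroup I] [Module R I]
    {J : Ideal R} {k : ℕ} {φ : M →ₗ[R] I} (h : ∀ r ∈ J ^ k, r • φ = 0) {s : S}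
    (hs : s ∈ (J.map (algebraMap R S)) ^ k) (m : M) : φ (s • m) = 0 := by
  rw [← Ideal.map_pow] at hs
  induction hs using Submodule.span_induction generalizing m with
  | mem x hx =>
    obtain ⟨r, hr, rfl⟩ := hx
    rw [algebraMap_smul, map_smul]
    exact LinearMap.congr_fun (h r hr) m
  | zero => rw [zero_smul, map_zero]
  | add x y _ _ hx hy => rw [add_smul, map_add, hx, hy, add_zero]
  | smul a x _ hx => rw [smul_eq_mul, mul_comm, mul_smul, hx]

theorem exists_pow_smul_linearMap_eq_zero {R : Type*} [CommRing R] [IsLocalRing R]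
    {M I : Type*} [AddCommGroup M] [Module R M]
    [Module.Finite R M] [AddCommGroup I] [Module R I] (φ : M →ₗ[R] I)
    (hI : ∀ y : I, ∃ k : ℕ, ∀ r ∈ maximalIdeal R ^ k, r • y = 0) :
    ∃ k : ℕ, ∀ r ∈ maximalIdeal R ^ k, r • φ = 0 := by
  obtain ⟨T, hT⟩ := (inferInstance : Module.Finite R M).fg_top
  choose k hk using hI
  refine ⟨T.sup fun m => k (φ m), fun r hr => ?_⟩
  refine LinearMap.ext_on hT fun m hm => ?_
  exact hk _ r (Ideal.pow_le_pow_right (Finset.le_sup (f := fun m => k (φ m)) hm) hr)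

variable {R : Type u} {S : Type v} [CommRing R] [IsLocalRing R] [CommRing S]
  [IsLocalRing S] [Algebra R S] [Module.Finite R S]

/-- Multiplication by an element of `S` on an `S`-module, as an `R`-linear map. -/
def smulLinearMap (R : Type*) {S M : Type*} [CommRing R] [CommRing S] [Algebra R S]
    [AddCommGroup M] [Module R M] [Module S M] [IsScalarTower R S M] (x : S) : M →ₗ[R] M :=
  (LinearMap.lsmul S M x).restrictScalars R

section QuotSMulTop

variable (R : Type*) {S : Type*} (M : Type*) [CommRing R] [CommRing S] [Algebra R S]
  [AddCommGroup M] [Module R M] [Module S M] [IsScalarTower R S M] (x : S)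

/-- The projection `M → M / x M`, as an `R`-linear map. -/
def quotSMulTopMk : M →ₗ[R] QuotSMulTop x M :=
  (x • (⊤ : Submodule S M)).mkQ.restrictScalars R

theorem quotSMulTopMk_surjective : Function.Surjective (quotSMulTopMk R M x) :=
  fun y => Submodule.mkQ_surjective (x • (⊤ : Submodule S M)) y

theorem exact_smulLinearMap_quotSMulTopMk :
    Function.Exact (smulLinearMap R x : M →ₗ[R] M) (quotSMulTopMk R M x) :=
  fun y => LinearMap.exact_lsmul_mkQ_smul_top M x y

end QuotSMulTop

/-- Every homomorphism from `M` to the `m`-power torsion essential extension `I` of `C`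
has image in `C`. -/
theorem comp_eq_zero_of_isWeaklyRegular {N I' C I D : Type u} [AddCommGroup N] [Module R N]
    [AddCommGroup I'] [Module R I'] [AddCommGroup C] [Module R C]
    [AddCommGroup I] [Module R I] [AddCommGroup D] [Module R D]
    {g' : I' →ₗ[R] C} {f : C →ₗ[R] I} {g : I →ₗ[R] D}
    (hI' : Module.Injective R I') (hf : Function.Injective f) (hfg : Function.Exact f g)
    (hess : f.HasEssentialRange)
    (hI : ∀ y : I, ∃ k : ℕ, ∀ r ∈ maximalIdeal R ^ k, r • y = 0) (T : ℕ)
    (hlift : ∀ (L : Type u) [AddCommGroup L] [Module R L],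
      Subsingleton (Abelian.Ext (ModuleCat.of R L) (ModuleCat.of R N) T) →
      ∀ φ : L →ₗ[R] C, ∃ ψ : L →ₗ[R] I', g' ∘ₗ ψ = φ)
    (xs : List S) (hxs : ∀ x ∈ xs, x ∈ maximalIdeal S) (hlen : xs.length ≤ T)
    (M : Type u) [AddCommGroup M] [Module R M] [Module S M] [IsScalarTower R S M]
    [Module.Finite R M] (hreg : RingTheory.Sequence.IsWeaklyRegular M xs)
    (hM : ∀ r ∈ maximalIdeal R, ∀ m : M, r • m ∈ Ideal.ofList xs • (⊤ : Submodule S M))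
    (hExt : ∀ i, T + 1 ≤ i + xs.length → i ≤ T →
      Subsingleton (Abelian.Ext (ModuleCat.of R M) (ModuleCat.of R N) i))
    (φ : M →ₗ[R] I) : g ∘ₗ φ = 0 := by
  induction xs generalizing M with
  | nil =>
    -- Here `m` kills `M`, so `φ` has values in the socle of `I`; a nonzero multiple of a socle
    -- element that lies in `C` has a unit multiplier.
    ext m
    by_contra hne
    have hm : ∀ r ∈ maximalIdeal R, r • φ m = 0 := fun r hr => by
      have := hM r hr m
      rw [Ideal.ofList_nil, Submodule.bot_smul, Submodule.mem_bot] at this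
      rw [← map_smul, this, map_zero]
    obtain ⟨r, c, hr, hr0⟩ := hess.exists_smul_eq (y := φ m) fun h0 => hne (by simp [h0])
    have hru : IsUnit r := by
      by_contra hru
      exact hr0 (hm r ((mem_maximalIdeal r).2 hru))
    obtain ⟨u, rfl⟩ := hru
    apply hne
    have : φ m = f ((↑u⁻¹ : R) • c) := by
      rw [map_smul, ← hr, smul_smul, Units.inv_mul, one_smul]
    rw [LinearMap.comp_apply, this, hfg.apply_apply_eq_zero, LinearMap.zero_apply]
  | cons x xs ih =>
    rw [RingTheory.Sequence.isWeaklyRegular_cons_iff] at hreg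
    obtain ⟨hx, hreg⟩ := hreg
    rw [List.length_cons] at hlen
    have hinj : Function.Injective (smulLinearMap R x : M →ₗ[R] M) := hx
    have ih' := ih (fun y hy => hxs y (List.mem_cons_of_mem _ hy)) (by omega) (QuotSMulTop x M)
      hreg ?_ ?_
    · -- homomorphisms carrying `x M` into `C` have image in `C`
      have key : ∀ χ : M →ₗ[R] I, (∀ m, g (χ (x • m)) = 0) → g ∘ₗ χ = 0 := by
        intro χ hχ
        let h : M →ₗ[R] C := (LinearEquiv.ofInjective f hf).symm.toLinearMap ∘ₗ
          (χ ∘ₗ smulLinearMap R x).codRestrict (LinearMap.range f) fun m => (hfg _).1 (hχ m)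
        have hfh : ∀ m, f (h m) = χ (x • m) := fun m => by
          have := (LinearEquiv.ofInjective f hf).apply_symm_apply
            ((χ ∘ₗ smulLinearMap R x).codRestrict (LinearMap.range f)
              (fun m => (hfg _).1 (hχ m)) m)
          exact congrArg Subtype.val this
        -- Lift `h` to `I'`, then extend along the injective multiplication by `x`. The correction
        -- `f ∘ g' ∘ h''` has values in `C` and agrees with `χ` on `x M`, so the difference factors
        -- through `M / x M`, where induction applies.
        obtain ⟨h', hh'⟩ := hlift M (hExt T (by rw [List.length_cons]; omega) le_rfl) h
        obtain ⟨h'', hh''⟩ := hI'.out (smulLinearMap R x) hx h'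
        have hx0 : (x • (⊤ : Submodule S M)).restrictScalars R ≤
            LinearMap.ker (χ - f ∘ₗ g' ∘ₗ h'') := by
          intro m hm
          obtain ⟨m, -, rfl⟩ := (Submodule.mem_smul_pointwise_iff_exists _ _ _).1 hm
          have h1 : h'' (x • m) = h' m := hh'' m
          have h2 : g' (h' m) = h m := LinearMap.congr_fun hh' m
          simp [h1, h2, hfh]
        have h3 := ih' (Submodule.liftQ _ _ hx0 ∘ₗ
          (Submodule.Quotient.restrictScalarsEquiv R (x • (⊤ : Submodule S M))).symm.toLinearMap)
        ext m
        have h4 : g ((χ - f ∘ₗ g' ∘ₗ h'') m) = 0 :=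
          LinearMap.congr_fun h3 (Submodule.Quotient.mk m)
        simpa [hfg.apply_apply_eq_zero] using h4
      -- By torsion `φ` kills `x ^ l M` for some `l`; `key`, applied to `φ` after multiplication by
      -- a power of `x`, lowers the exponent one step at a time.
      obtain ⟨k, hk⟩ := exists_pow_smul_linearMap_eq_zero φ hI
      obtain ⟨n, hn⟩ := exists_pow_mem_map_maximalIdeal (R := R) (hxs x List.mem_cons_self)
      have h0 : ∀ m, g (φ (x ^ (n * k) • m)) = 0 := fun m => by
        rw [map_smul_eq_zero_of_mem_pow_map hk (by rw [pow_mul]; exact Ideal.pow_mem_pow hn k),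
          map_zero]
      generalize n * k = l at h0
      induction l with
      | zero => exact LinearMap.ext fun m => by simpa using h0 m
      | succ l ihl =>
        refine ihl fun m => ?_
        have := key (φ ∘ₗ smulLinearMap R (x ^ l)) fun m => by
          have := h0 m
          rwa [pow_succ, mul_smul] at this
        exact LinearMap.congr_fun this m
    · intro r hr m
      obtain ⟨m, rfl⟩ := Submodule.mkQ_surjective _ m
      have h1 := Submodule.mem_map_of_mem (f := (x • (⊤ : Submodule S M)).mkQ) (hM r hr m)
      rw [Submodule.map_smul'', Ideal.ofList_cons, Submodule.sup_smul, Submodule.map_top,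
        Submodule.range_mkQ] at h1
      have h2 : Ideal.span {x} • (⊤ : Submodule S (QuotSMulTop x M)) = ⊥ := by
        rw [Submodule.ideal_span_singleton_smul, eq_bot_iff]
        rintro y hy
        obtain ⟨y, -, rfl⟩ := (Submodule.mem_smul_pointwise_iff_exists _ _ _).1 hy
        obtain ⟨y, rfl⟩ := Submodule.mkQ_surjective _ y
        rw [Submodule.mem_bot, ← map_smul, Submodule.mkQ_apply, Submodule.Quotient.mk_eq_zero]
        exact Submodule.smul_mem_pointwise_smul y x ⊤ trivial
      rw [h2, bot_sup_eq] at h1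
      exact h1
    -- Vanishing in degree `i` for `M / x M` uses degrees `i - 1` and `i` for `M`: each quotient
    -- costs the lowest degree of the range.
    · intro i hi hiT
      obtain ⟨i, rfl⟩ : ∃ k, i = k + 1 := ⟨i - 1, by omega⟩
      have h1 := hExt i (by rw [List.length_cons]; omega) (by omega)
      have h2 := hExt (i + 1) (by rw [List.length_cons]; omega) hiT
      exact subsingleton_ext_third hinj (exact_smulLinearMap_quotSMulTopMk R M x)
        (quotSMulTopMk_surjective R M x) N h1 h2

end Ulrich

/-! ### Vanishing criteria for flat modules -/

section FlatVanishing

open TensorProduct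

variable {R : Type u} [CommRing R] [IsNoetherianRing R]

theorem isNilpotent_annihilator_of_support_eq_univ (M : Type*) [AddCommGroup M] [Module R M]
    [Module.Finite R M] (h : Module.support R M = Set.univ) :
    IsNilpotent (Module.annihilator R M) := by
  have hle : Module.annihilator R M ≤ nilradical R := by
    rw [nilradical_eq_sInf]
    refine le_sInf fun p hp => ?_
    have : (⟨p, hp⟩ : PrimeSpectrum R) ∈ Module.support R M := h ▸ trivial
    exact Module.mem_support_iff_of_finite.1 this
  obtain ⟨n, hn⟩ := IsNoetherianRing.isNilpotent_nilradical R
  exact ⟨n, le_bot_iff.1 ((Ideal.pow_right_mono hle n).trans hn.le)⟩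

/-- A flat module annihilated by tensoring with a finite module of full support is zero. -/
theorem subsingleton_of_subsingleton_tensorProduct (M Z : Type*) [AddCommGroup M] [Module R M]
    [Module.Finite R M] (h : Module.support R M = Set.univ) [AddCommGroup Z] [Module R Z]
    [Module.Flat R Z] (hMZ : Subsingleton (M ⊗[R] Z)) : Subsingleton Z := by
  set J := Module.annihilator R M with hJ
  obtain ⟨n, m, hm⟩ := Module.Finite.exists_fin (R := R) (M := M)
  -- Generators of `M` embed `R / J` in a power of `M`. By flatness `(R / J) ⊗ Z` embeds in zero, so
  -- `Z = J Z`; full support makes `J` nilpotent.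
  let ι : R →ₗ[R] (Fin n → M) := LinearMap.pi fun i => LinearMap.toSpanSingleton R M (m i)
  have hι : ∀ r, ι r = 0 ↔ r ∈ J := fun r => by
    rw [hJ, ← Submodule.annihilator_top, ← hm, Submodule.mem_annihilator_span]
    simp [ι, funext_iff]
  let ι' : R ⧸ J →ₗ[R] (Fin n → M) := Submodule.liftQ J ι fun r hr => (hι r).2 hr
  have hι' : Function.Injective ι' := by
    rw [← LinearMap.ker_eq_bot]
    refine Submodule.ker_liftQ_eq_bot _ _ _ fun r hr => (hι r).1 hr
  have hsub : Subsingleton ((Fin n → M) ⊗[R] Z) := by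
    refine subsingleton_of_forall_eq 0 fun w => ?_
    induction w with
    | zero => rfl
    | add x y hx hy => rw [hx, hy, add_zero]
    | tmul v z =>
      rw [← Finset.univ_sum_single v, TensorProduct.sum_tmul]
      refine Finset.sum_eq_zero fun i _ => ?_
      have := congrArg ((LinearMap.single R (fun _ => M) i).rTensor Z)
        (Subsingleton.elim (v i ⊗ₜ[R] z) 0)
      simpa using this
  have hsub' : Subsingleton ((R ⧸ J) ⊗[R] Z) :=
    (Module.Flat.rTensor_preserves_injective_linearMap (M := Z) ι' hι').subsingleton
  have htop : J • (⊤ : Submodule R Z) = ⊤ := by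
    have := (TensorProduct.quotTensorEquivQuotSMul Z J).symm.toEquiv.subsingleton
    exact Submodule.Quotient.subsingleton_iff.1 this
  obtain ⟨k, hk⟩ := isNilpotent_annihilator_of_support_eq_univ M h
  have hpow : ∀ k, J ^ k • (⊤ : Submodule R Z) = ⊤ := fun k => by
    induction k with
    | zero => simp
    | succ k ih => rw [pow_succ, Submodule.mul_smul, htop, ih]
  have := hpow k
  rw [hk, Ideal.zero_eq_bot, Submodule.bot_smul] at this
  exact (Submodule.subsingleton_iff R).1 (subsingleton_of_bot_eq_top this)

/-- An element of a flat module which vanishes at all associated primes of the ring is zero. -/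
theorem eq_zero_of_forall_associatedPrimes {F : Type*} [AddCommGroup F] [Module R F]
    [Module.Flat R F] (x : F) (h : ∀ p ∈ associatedPrimes R R, ∃ u ∉ p, u • x = 0) : x = 0 := by
  let J : Ideal R := LinearMap.ker (LinearMap.toSpanSingleton R F x)
  -- Prime avoidance puts a nonzerodivisor in the annihilator of `x`, and nonzerodivisors are
  -- regular on flat modules.
  have hJ : ¬ ((J : Set R) ⊆ ⋃ p ∈ associatedPrimes R R, (p : Set R)) := by
    intro hle
    obtain ⟨p, hp, hJp⟩ := (J.subset_union_prime_finite (associatedPrimes.finite R R) (f := id)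
      0 0 fun _ h _ _ => h.isPrime).1 hle
    obtain ⟨u, hu, hux⟩ := h p hp
    exact hu (hJp (by simpa [J] using hux))
  obtain ⟨s, hsJ, hs⟩ := Set.not_subset.1 hJ
  rw [biUnion_associatedPrimes_eq_compl_nonZeroDivisors, Set.mem_compl_iff, not_not] at hs
  have hreg : IsSMulRegular F s := Module.Flat.isSMulRegular_of_nonZeroDivisors hs
  refine hreg ?_
  have : s • x = 0 := by simpa [J] using hsJ
  simpa using this

end FlatVanishing

/-! ### Duality into an injective module -/

section Dual

variable {R : Type u} [CommRing R] {E X Y Z : Type u} [AddCommGroup E] [Module R E]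
  [AddCommGroup X] [Module R X] [AddCommGroup Y] [Module R Y] [AddCommGroup Z] [Module R Z]
  {f : X →ₗ[R] Y} {g : Y →ₗ[R] Z}

theorem lcomp_injective_of_surjective (hg : Function.Surjective g) :
    Function.Injective (LinearMap.lcomp R E g) := fun φ ψ h =>
  LinearMap.ext fun z => by
    obtain ⟨y, rfl⟩ := hg z
    exact LinearMap.congr_fun h y

theorem Module.Injective.lcomp_surjective (hE : Module.Injective R E)
    (hf : Function.Injective f) : Function.Surjective (LinearMap.lcomp R E f) := fun φ => by
  obtain ⟨ψ, hψ⟩ := hE.out f hf φ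
  exact ⟨ψ, LinearMap.ext hψ⟩

theorem Module.Injective.exact_lcomp (hE : Module.Injective R E) (hfg : Function.Exact f g) :
    Function.Exact (LinearMap.lcomp R E g) (LinearMap.lcomp R E f) := by
  intro φ
  constructor
  · intro hφ
    refine hE.exists_comp_eq g φ fun y hy => ?_
    obtain ⟨x, rfl⟩ := (hfg y).1 hy
    exact LinearMap.congr_fun hφ x
  · rintro ⟨ψ, rfl⟩
    ext x
    change ψ (g (f x)) = 0
    rw [hfg.apply_apply_eq_zero, map_zero]

open IsLocalRing in
/-- The injective hull of the residue field is a cogenerator. -/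
theorem subsingleton_of_subsingleton_linearMap_injectiveHull [IsLocalRing R]
    (h : Subsingleton (X →ₗ[R] injectiveHull R (ResidueField R))) : Subsingleton X := by
  refine subsingleton_of_forall_eq 0 fun x => ?_
  by_contra hx
  let J : Ideal R := LinearMap.ker (LinearMap.toSpanSingleton R X x)
  have hJ : J ≤ maximalIdeal R := le_maximalIdeal fun htop => hx (by
    have : (1 : R) ∈ J := htop ▸ trivial
    simpa [J] using this)
  let φ : R →ₗ[R] injectiveHull R (ResidueField R) :=
    injectiveHullEmbedding R (ResidueField R) ∘ₗ Algebra.linearMap R (ResidueField R)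
  obtain ⟨ψ, hψ⟩ := (isInjectiveHull_injectiveHull R (ResidueField R)).1.exists_comp_eq
    (LinearMap.toSpanSingleton R X x) φ fun r hr => by
      have : algebraMap R (ResidueField R) r = 0 := (residue_eq_zero_iff r).2 (hJ hr)
      rw [LinearMap.mem_ker, LinearMap.comp_apply, Algebra.linearMap_apply, this, map_zero]
  have h1 : φ 1 = 0 := by rw [← hψ, h.elim ψ 0, LinearMap.zero_comp, LinearMap.zero_apply]
  have h2 := injectiveHullEmbedding_injective R (ResidueField R) (h1.trans (map_zero _).symm)
  simp at h2

end Dual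

/-! ### The main argument -/

section Main

open IsLocalRing TensorProduct

/-- If `M ⊗ X₂ → M ⊗ F` vanishes, `0 → X₂ → F → X₁ → 0` is exact, and `F` and, locally at the
associated primes of `R`, also `X₁` are flat, then `X₂ = 0`. -/
theorem subsingleton_of_lTensor_eq_zero {R : Type u} [CommRing R] [IsNoetherianRing R]
    {M X₂ F X₁ : Type u} [AddCommGroup M] [Module R M] [Module.Finite R M]
    (hM : Module.support R M = Set.univ) [AddCommGroup X₂] [Module R X₂] [AddCommGroup F]
    [Module R F] [AddCommGroup X₁] [Module R X₁] {a : X₂ →ₗ[R] F} {b : F →ₗ[R] X₁}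
    (ha : Function.Injective a) (hab : Function.Exact a b) (hb : Function.Surjective b)
    [Module.Flat R F]
    (hX₁ : ∀ p ∈ associatedPrimes R R, ∀ [p.IsPrime],
      Module.Flat (Localization.AtPrime p) (LocalizedModule p.primeCompl X₁))
    (hX₂ : ∀ p ∈ associatedPrimes R R, ∀ [p.IsPrime],
      Module.Flat (Localization.AtPrime p) (LocalizedModule p.primeCompl X₂))
    (h0 : a.lTensor M = 0) : Subsingleton X₂ := by
  refine subsingleton_of_forall_eq 0 fun x => ha ?_
  rw [map_zero]
  refine eq_zero_of_forall_associatedPrimes (R := R) _ fun p hp => ?_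
  have := hp.isPrime
  have := hX₁ p hp
  have := hX₂ p hp
  have h1 : Module.Flat R (LocalizedModule p.primeCompl X₁) :=
    Module.Flat.trans R (Localization.AtPrime p) _
  have h2 : Module.Flat R (LocalizedModule p.primeCompl X₂) :=
    Module.Flat.trans R (Localization.AtPrime p) _
  -- Flatness of the localized quotient `X₁` keeps the localized `a` injective after tensoring with
  -- `M`; being also zero, it forces its source to vanish.
  have hinj := LinearMap.lTensor_injective_of_exact_of_flat
    ((LocalizedModule.map p.primeCompl b).restrictScalars R)
    (LocalizedModule.map_surjective p.primeCompl b hb)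
    ((LocalizedModule.map p.primeCompl a).restrictScalars R)
    (LocalizedModule.map_injective p.primeCompl a ha)
    (LocalizedModule.map_exact p.primeCompl a b hab) M
  have hsub : Subsingleton (M ⊗[R] LocalizedModule p.primeCompl X₂) := by
    refine subsingleton_of_forall_eq 0 fun w => ?_
    induction w with
    | zero => rfl
    | add x y hx hy => rw [hx, hy, add_zero]
    | tmul m y =>
      refine hinj ?_
      rw [map_zero]
      induction y using LocalizedModule.induction_on with
      | h y s =>
        have h3 : m ⊗ₜ[R] a y = 0 := LinearMap.congr_fun h0 (m ⊗ₜ y)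
        have h4 := congrArg ((LocalizedModule.divBy s ∘ₗ
          LocalizedModule.mkLinearMap p.primeCompl F).lTensor M) h3
        rw [LinearMap.lTensor_tmul, map_zero] at h4
        replace h4 : m ⊗ₜ[R]
            (LocalizedModule.mk (a y) (1 * s) : LocalizedModule p.primeCompl F) = 0 := h4
        rw [one_mul] at h4
        rw [LinearMap.lTensor_tmul, LinearMap.restrictScalars_apply, LocalizedModule.map_mk]
        exact h4
  have := subsingleton_of_subsingleton_tensorProduct M (LocalizedModule p.primeCompl X₂) hM hsub
  have h5 : (LocalizedModule.mk x 1 : LocalizedModule p.primeCompl X₂) = LocalizedModule.mk 0 1 :=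
    Subsingleton.elim _ _
  obtain ⟨u, hu⟩ := LocalizedModule.mk_eq.1 h5
  refine ⟨u, u.2, ?_⟩
  have : (u : R) • x = 0 := by simpa [Submonoid.smul_def] using hu
  rw [← map_smul, this, map_zero]

/-- Local finiteness of the injective dimension on the punctured spectrum makes the cosyzygies
from the `d`-th on torsion. -/
theorem minimalCosyzygy_torsion {R : Type u} [CommRing R] [IsLocalRing R] [IsNoetherianRing R]
    {d : ℕ} (hd : ringKrullDim R = d) {N : ModuleCat.{u} R} {p : Ideal R} [p.IsPrime]
    (hp : p ≠ maximalIdeal R)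
    (hN : injectiveDimension
      (ModuleCat.of (Localization.AtPrime p) (LocalizedModule.AtPrime p N)) < ⊤) {j : ℕ}
    (hj : d ≤ j) (y : minimalCosyzygy N j) : ∃ u ∉ p, u • y = 0 := by
  obtain ⟨n, hn⟩ := (injectiveDimension_ne_top_iff _).1 hN.ne
  have hseq := isCosyzygySequence_minimalCosyzygy N
  -- As `p` is strictly below the maximal ideal, `R_p` has dimension at most `d - 1`. So the
  -- cosyzygies are injective at `p` already from index `d - 1`, and therefore vanish at `p` from
  -- index `d`.
  obtain ⟨e, rfl, hde⟩ : ∃ e : ℕ, d = e + 1 ∧ ringKrullDim (Localization.AtPrime p) ≤ e := by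
    have hlt : p < maximalIdeal R := lt_of_le_of_ne (le_maximalIdeal Ideal.IsPrime.ne_top') hp
    have hh := Ideal.height_strict_mono_of_isPrime_of_isPrime hlt
    have hmd : (maximalIdeal R).height = d := by
      rw [← maximalIdeal_height_eq_ringKrullDim] at hd
      exact_mod_cast hd
    rw [hmd] at hh
    obtain ⟨k, hk⟩ := ENat.ne_top_iff_exists.1 hh.ne_top
    rw [← hk] at hh
    have hkd : k < d := by exact_mod_cast hh
    obtain ⟨e, rfl⟩ : ∃ e, d = e + 1 := ⟨d - 1, by omega⟩
    refine ⟨e, rfl, ?_⟩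
    rw [IsLocalization.AtPrime.ringKrullDim_eq_height p, ← hk]
    have hke : (k : ℕ∞) ≤ (e : ℕ∞) := Nat.cast_le.2 (by omega)
    exact WithBot.coe_le_coe.2 hke
  obtain ⟨j, rfl⟩ : ∃ k, j = k + 1 := ⟨j - 1, by omega⟩
  exact exists_notMem_smul_eq_zero_of_injective (hseq.mono j)
    (hasEssentialRange_injectiveHullEmbedding R _) (hseq.exact j) (hseq.epi j) p
    ((hseq.localizedModule p.primeCompl).injective_of_hasInjectiveDimensionLT
      (hasInjectiveDimensionLT_of_ringKrullDim_le hde _ hn) (by omega)) y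

end Main

theorem mainTheorem6
    {R : Type u} {S : Type v} [CommRing R] [IsLocalRing R] [IsNoetherianRing R]
    [CommRing S] [IsLocalRing S] [IsNoetherianRing S]
    [Algebra R S] [IsLocalHom (algebraMap R S)] [Module.Finite R S]
    (d : ℕ) (hd : ringKrullDim R = d) (hd1 : 1 ≤ d)
    {M : Type u} [AddCommGroup M] [Module R M] [Module S M] [IsScalarTower R S M]
    {N : Type u} [AddCommGroup N] [Module R N]
    (t : ℕ) (ht : 1 ≤ t)
    (hExt : ∀ i : ℕ, t ≤ i → i ≤ t + d - 1 →
      Subsingleton (CategoryTheory.Abelian.Ext (ModuleCat.of R M) (ModuleCat.of R N) i))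
    (hMfin : Module.Finite S M) (hMsupp : Module.support R M = Set.univ)
    (hreg : ∃ x : List S, x.length = d ∧ (∀ a ∈ x, a ∈ IsLocalRing.maximalIdeal S) ∧
      RingTheory.Sequence.IsRegular M x ∧
      ∀ r ∈ IsLocalRing.maximalIdeal R, ∀ m : M, r • m ∈ Ideal.ofList x • (⊤ : Submodule S M))
    (hid : ∀ (p : Ideal R) [p.IsPrime], p ≠ IsLocalRing.maximalIdeal R →
      CategoryTheory.injectiveDimension
        (ModuleCat.of (Localization.AtPrime p) (LocalizedModule.AtPrime p N)) < ⊤)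
    (hfd : ∀ (p : Ideal R) [p.IsPrime], p ∈ associatedPrimes R R →
      flatDimension (Localization.AtPrime p)
        (LocalizedModule.AtPrime p (MatlisDual R N)) < ⊤) :
    CategoryTheory.injectiveDimension (ModuleCat.of R N) ≤ d := by
  have hMR : Module.Finite R M := Module.Finite.trans S M
  obtain ⟨xs, hlen, hxs, hxreg, hmM⟩ := hreg
  -- `T + 1 = t + d - 1` is the last degree in which Ext is assumed to vanish; it is at least `d`
  -- because `1 ≤ t`.
  obtain ⟨T, hT⟩ : ∃ T, t + d = T + 2 := ⟨t + d - 2, by omega⟩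
  have hseq := isCosyzygySequence_minimalCosyzygy (ModuleCat.of R N)
  set C : ℕ → ModuleCat.{u} R := minimalCosyzygy (ModuleCat.of R N) with hC
  set E := injectiveHull R (IsLocalRing.ResidueField R) with hE
  have hEinj : Module.Injective R E :=
    (isInjectiveHull_injectiveHull R (IsLocalRing.ResidueField R)).1
  have hess : ∀ j, (injectiveHullEmbedding R (C j)).HasEssentialRange := fun j =>
    hasEssentialRange_injectiveHullEmbedding R _
  have hItors : ∀ y : injectiveHull R (C (T + 1)),
      ∃ k : ℕ, ∀ r ∈ IsLocalRing.maximalIdeal R ^ k, r • y = 0 := by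
    refine fun y => exists_pow_maximalIdeal_smul_eq_zero y fun p _ hp => ?_
    refine (hess (T + 1)).exists_notMem_smul_eq_zero p y fun a c hac => ?_
    obtain ⟨u, hu, huc⟩ := minimalCosyzygy_torsion hd hp (hid p hp) (by omega) c
    exact ⟨u, hu, by rw [hac, ← map_smul, huc, map_zero]⟩
  have hzero : ∀ φ : M →ₗ[R] injectiveHull R (C (T + 1)),
      minimalCosyzygyMk (ModuleCat.of R N) (T + 1) ∘ₗ φ = 0 := by
    intro φ
    -- Vanishing of `Ext^(T+1)(L, N)` shifts to `Ext^1(L, C T)`, the obstruction to lifting maps `L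
    -- → C (T + 1)` to the injective hull of `C T`.
    refine comp_eq_zero_of_isWeaklyRegular (N := N) (g' := minimalCosyzygyMk (ModuleCat.of R N) T)
      (hseq.injective T) (hseq.mono (T + 1)) (hseq.exact (T + 1)) (hess (T + 1)) hItors (T + 1)
      (fun L _ _ hL φ => exists_lift_of_subsingleton_ext_one (hseq.mono T) (hseq.exact T)
        (hseq.epi T) (hseq.subsingleton_ext 0 T (by rwa [zero_add])) φ)
      xs hxs (by omega) M hxreg.toIsWeaklyRegular hmM (fun i hi hiT => hExt i (by omega) (by omega))
      φ
  -- the dual sequences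
  have hflat : ∀ j, Module.Flat R (injectiveHull R (C j) →ₗ[R] E) := fun j =>
    flat_linearMap_of_injective (hseq.injective j) hEinj
  have ha : ∀ j, Function.Injective
      (LinearMap.lcomp R E (minimalCosyzygyMk (ModuleCat.of R N) j)) := fun j =>
    lcomp_injective_of_surjective (hseq.epi j)
  have hab : ∀ j, Function.Exact (LinearMap.lcomp R E (minimalCosyzygyMk (ModuleCat.of R N) j))
      (LinearMap.lcomp R E (injectiveHullEmbedding R (C j))) := fun j =>
    hEinj.exact_lcomp (hseq.exact j)
  have hb : ∀ j, Function.Surjective (LinearMap.lcomp R E (injectiveHullEmbedding R (C j))) :=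
    fun j => hEinj.lcomp_surjective (hseq.mono j)
  have hlocflat : ∀ j, d ≤ j → ∀ p ∈ associatedPrimes R R, ∀ [p.IsPrime],
      Module.Flat (Localization.AtPrime p) (LocalizedModule p.primeCompl (C j →ₗ[R] E)) := by
    intro j hj p hp _
    obtain ⟨n, hn⟩ := (flatDimension_lt_top_iff _ _).1 (hfd p hp)
    have hdim : ringKrullDim (Localization.AtPrime p) ≤ d :=
      hd ▸ ringKrullDim_localization_atPrime_le p
    -- The zeroth syzygy is the localized Matlis dual of `N`, since `C 0` is `N` by definition.
    exact flat_syzygy_of_hasFlatDimensionLE hdim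
      (X := fun j => LocalizedModule p.primeCompl (C j →ₗ[R] E))
      (F := fun j => LocalizedModule p.primeCompl (injectiveHull R (C j) →ₗ[R] E))
      (a := fun j => LocalizedModule.map p.primeCompl
        (LinearMap.lcomp R E (minimalCosyzygyMk (ModuleCat.of R N) j)))
      (b := fun j => LocalizedModule.map p.primeCompl
        (LinearMap.lcomp R E (injectiveHullEmbedding R (C j))))
      (fun j => have := hflat j; inferInstance)
      (fun j => LocalizedModule.map_injective p.primeCompl _ (ha j))
      (fun j => LocalizedModule.map_exact p.primeCompl _ _ (hab j))
      (fun j => LocalizedModule.map_surjective p.primeCompl _ (hb j)) hn hj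
  have := hflat (T + 1)
  have hD : Subsingleton (C (T + 2) →ₗ[R] E) := by
    refine subsingleton_of_lTensor_eq_zero hMsupp (ha (T + 1)) (hab (T + 1)) (hb (T + 1))
      (hlocflat (T + 1) (by omega)) (hlocflat (T + 2) (by omega)) ?_
    refine LinearMap.ext fun z => tensorHomEval_injective M hEinj (LinearMap.ext fun φ => ?_)
    rw [tensorHomEval_lTensor, hzero φ]
    simp
  have hD0 := subsingleton_of_subsingleton_linearMap_injectiveHull hD
  -- The zero module `C (T + 2)` is injective, which gives only the bound `T + 2`; the Krull
  -- dimension improves it to `d`.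
  rw [CategoryTheory.injectiveDimension_le_iff]
  refine hasInjectiveDimensionLT_of_ringKrullDim_le hd.le _
    (hseq.hasInjectiveDimensionLT_of_injective (j := T + 2) ?_)
  exact ⟨fun _ _ _ _ _ _ _ _ _ => ⟨0, fun _ => Subsingleton.elim _ _⟩⟩
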